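/- Let $k$ be a differential field of characteristic $0$ with commuting derivations $\delta_1,\dots,\delta_m$, let $k\{Y\}$, $Y=\{y_1,\dots,y_n\}$, be the ring of differential polynomials over $k$, i.e. the polynomial ring over $k$ in the set $\Theta Y$ of all derivatives $\theta y_j$, where $\theta$ runs through the monoid $\Theta$ of derivative operators $\delta_1^{k_1}\cdots\delta_m^{k_m}$. Fix a ranking on $\Theta Y$, i.e. a total order with $\theta u\ge u$, and $u\ge v\Rightarrow \theta u\ge\theta v$. For $f\in k\{Y\}\setminus k$, the leader $\mathrm{ld}\,f$ is the highest derivative $u$ in $f$, the rank of $f$ is $\mathrm{rk}\,f=u^d$ with $d=\deg_u f$, and the initial of $f$ is the coefficient of $u^d$ in $f$; ranks are ordered first by $u$, then by $d$. A polynomial $f$ is algebraically reduced w.r.t. $g$ if $\deg_{\mathrm{ld}\,g} f<\deg_{\mathrm{ld}\,g} g$, and reduced w.r.t. $g$ if, moreover, no proper derivative of $\mathrm{ld}\,g$ appears in $f$. A subset of $k\{Y\}\setminus k$ is autoreduced (algebraically autoreduced) if each element is reduced (algebraically reduced) w.r.t. all the others; it is weak d-triangular if the leaders of its elements are distinct and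 none of them is a derivative of another one. A set $\mathbb A$ has lower rank than $\mathbb B$ if there is $f\in\mathbb A$ such that no element of $\mathbb B$ has rank $\mathrm{rk}\,f$, and $\mathbb A$ and $\mathbb B$ have the same ranks below $\mathrm{rk}\,f$ (for finite autoreduced sets, listed by increasing rank, this is the usual comparison of rank sequences: the first difference decides, and a proper extension of a sequence is lower than the sequence). A characteristic set (algebraic characteristic set) of $X\subseteq k\{Y\}$ is an autoreduced (algebraically autoreduced) subset of $X$ of the lowest rank. A characteristic set $\mathbb A$ of $X$ is canonical if, for each $f\in\mathbb A$, the initial of $f$ lies in $k[N]$, $f$ is monic (its leading coefficient is $1$ for the lexicographic monomial order induced by the ranking) and $f$ has no factors in $k[N]\setminus k$, where $N=\Theta Y\setminus\Theta\,\mathrm{ld}\,\mathbb A$; an algebraic characteristic set $\mathbb A$ of a subset of $k[V]$, $V\subseteq\Theta Y$, is canonical if the same holds with $N=V\setminus\mathrm{ld}\,\mathbb A$. Let $I$ be a prime differential ideal of $k\{Y\}$, let $\mathbb C$ be the canonical characteristic set of $I$, and let $V\subseteq\Theta Y$ be such that $J=I\cap k[V]$ contains $\mathbb C$. Then $J$ has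 exactly one canonical algebraic characteristic set $\mathbb D$, it contains $\mathbb C$, and $\mathbb C$ is the weak d-triangular subset of $\mathbb D$ of the least rank, i.e. $\mathbb C$ is a weak d-triangular subset of $\mathbb D$ of the least rank and is the only one. -/

import Mathlib

noncomputable section

namespace DiffAlg

open MvPolynomial

/-- The derivative `δ₁^(k₁) ⋯ δₘ^(kₘ) y_j`, an element of `ΘY`.  Here `op` is the exponent vector
`(k₁, …, kₘ)` of the derivative operator and `var` is the index `j` of the differential
indeterminate. -/
@[ext]
structure Deriv (m n : ℕ) where
  op : Fin m →₀ ℕ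
  var : Fin n

/-- The action `θ₁ (θ₂ y_j) = (θ₁ θ₂) y_j` of derivative operators on derivatives; the monoid `Θ`
is written additively, through exponent vectors. -/
def act {m n : ℕ} (θ : Fin m →₀ ℕ) (u : Deriv m n) : Deriv m n := ⟨θ + u.op, u.var⟩

/-- The set `ΘS` of all derivatives of the elements of a set `S` of derivatives. -/
def derivsOf {m n : ℕ} (S : Set (Deriv m n)) : Set (Deriv m n) :=
  {v | ∃ u ∈ S, ∃ θ : Fin m →₀ ℕ, v = act θ u}

/-- `v` is a proper derivative of `u`: `v = θ u` with `θ ≠ 1`. -/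
def IsProperDerivative {m n : ℕ} (v u : Deriv m n) : Prop :=
  ∃ θ : Fin m →₀ ℕ, θ ≠ 0 ∧ v = act θ u

/-- A linear order on `ΘY` is a ranking if `θ u ≥ u`, and `u ≥ v` implies `θ u ≥ θ v`. -/
structure IsRanking (m n : ℕ) [LinearOrder (Deriv m n)] : Prop where
  le_act : ∀ (θ : Fin m →₀ ℕ) (u : Deriv m n), u ≤ act θ u
  act_le_act : ∀ (θ : Fin m →₀ ℕ) (u v : Deriv m n), v ≤ u → act θ v ≤ act θ u

/-- The ring `k{y₁, …, yₙ}` of differential polynomials in `m` derivations: commutative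
polynomials over `k` in the variables `ΘY`. -/
abbrev DiffPoly (k : Type*) [Field k] (m n : ℕ) := MvPolynomial (Deriv m n) k

/-- Application of a derivation of `k` to the coefficients of a polynomial. -/
def coeffMap {k : Type*} [Field k] {m n : ℕ} (D : Derivation ℤ k k) (f : DiffPoly k m n) :
    DiffPoly k m n :=
  ∑ s ∈ f.support, monomial s (D (f.coeff s))

theorem coeff_coeffMap {k : Type*} [Field k] {m n : ℕ} (D : Derivation ℤ k k)
    (f : DiffPoly k m n) (s : Deriv m n →₀ ℕ) : (coeffMap D f).coeff s = D (f.coeff s) := by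
  classical
  unfold coeffMap
  rw [coeff_sum]
  simp only [coeff_monomial]
  rw [Finset.sum_ite_eq']
  split_ifs with h
  · rfl
  · rw [notMem_support_iff.mp h, map_zero]

theorem coeffMap_mul {k : Type*} [Field k] {m n : ℕ} (D : Derivation ℤ k k)
    (f g : DiffPoly k m n) : coeffMap D (f * g) = f * coeffMap D g + g * coeffMap D f := by
  classical
  rw [mul_comm g]
  ext s
  simp only [coeff_add, coeff_coeffMap, coeff_mul, map_sum, ← Finset.sum_add_distrib]
  refine Finset.sum_congr rfl fun x _ => ?_
  rw [Derivation.leibniz, smul_eq_mul, smul_eq_mul]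
  ring

/-- The derivation `δ_i` of `k{Y}` that extends the derivation `d i` of `k` and maps each
derivative `u` to `δ_i u`. -/
def delta {k : Type*} [Field k] {m n : ℕ} (d : Fin m → Derivation ℤ k k) (i : Fin m)
    (f : DiffPoly k m n) : DiffPoly k m n :=
  coeffMap (d i) f + mkDerivation k (fun u : Deriv m n => X (act (Finsupp.single i 1) u)) f

theorem delta_add {k : Type*} [Field k] {m n : ℕ} (d : Fin m → Derivation ℤ k k) (i : Fin m)
    (f g : DiffPoly k m n) : delta d i (f + g) = delta d i f + delta d i g := by
  have h : coeffMap (d i) (f + g) = coeffMap (d i) f + coeffMap (d i) g := by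
    ext s
    simp only [coeff_add, coeff_coeffMap, map_add]
  unfold delta
  rw [h, map_add]
  ring

theorem delta_mul {k : Type*} [Field k] {m n : ℕ} (d : Fin m → Derivation ℤ k k) (i : Fin m)
    (f g : DiffPoly k m n) : delta d i (f * g) = f * delta d i g + g * delta d i f := by
  unfold delta
  rw [coeffMap_mul, Derivation.leibniz, smul_eq_mul, smul_eq_mul]
  ring

theorem delta_C {k : Type*} [Field k] {m n : ℕ} (d : Fin m → Derivation ℤ k k) (i : Fin m)
    (a : k) : delta d i (C a : DiffPoly k m n) = C (d i a) := by
  classical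
  have h : coeffMap (d i) (C a : DiffPoly k m n) = C (d i a) := by
    ext s
    rw [coeff_coeffMap, coeff_C, coeff_C]
    split_ifs <;> simp
  unfold delta
  rw [h, ← algebraMap_eq, Derivation.map_algebraMap, add_zero]

theorem delta_X {k : Type*} [Field k] {m n : ℕ} (d : Fin m → Derivation ℤ k k) (i : Fin m)
    (u : Deriv m n) :
    delta d i (X u : DiffPoly k m n) = X (act (Finsupp.single i 1) u) := by
  classical
  have h : coeffMap (d i) (X u : DiffPoly k m n) = 0 := by
    ext s
    rw [coeff_coeffMap, coeff_X, coeff_zero]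
    split_ifs <;> simp
  unfold delta
  rw [h, mkDerivation_X, zero_add]

/-- An ideal of `k{Y}` is differential if it is closed under all the derivations. -/
def IsDifferentialIdeal {k : Type*} [Field k] {m n : ℕ} (d : Fin m → Derivation ℤ k k)
    (I : Ideal (DiffPoly k m n)) : Prop :=
  ∀ (i : Fin m), ∀ f ∈ I, delta d i f ∈ I

/-- The algebraic section `I ∩ k[V]`. -/
def algSection {k : Type*} [Field k] {m n : ℕ} (I : Ideal (DiffPoly k m n))
    (V : Set (Deriv m n)) : Set (DiffPoly k m n) :=
  {f | f ∈ I ∧ f ∈ supported k V}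

open Classical in
/-- The coefficient of `u ^ d` in `f`, viewed as a univariate polynomial in `u`, for
`d = deg_u f`.  For `u` the leader of `f` it is the initial of `f`. -/
def topCoeff {k : Type*} [Field k] {m n : ℕ} (f : DiffPoly k m n) (u : Deriv m n) :
    DiffPoly k m n :=
  ∑ s ∈ f.support with s u = f.degreeOf u, monomial (s.erase u) (f.coeff s)

section Ranked

variable {k : Type*} [Field k] {m n : ℕ} [LinearOrder (Deriv m n)]

/-- The leader of `f`: the highest derivative that appears in `f`.  It is `⊥` exactly when
`f` lies in `k`. -/
def leader (f : DiffPoly k m n) : WithBot (Deriv m n) := f.vars.max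

/-- The rank `u ^ d` of `f`, where `u` is the leader of `f` and `d = deg_u f`, encoded as the
pair `(u, d)`; ranks are compared lexicographically.  It is `⊥` exactly when `f` lies in `k`. -/
def rk (f : DiffPoly k m n) : WithBot (Deriv m n ×ₗ ℕ) :=
  (leader f).map fun u => toLex (u, f.degreeOf u)

/-- The set `ld A` of leaders of the elements of `A`. -/
def leaders (A : Set (DiffPoly k m n)) : Set (Deriv m n) := {u | ∃ f ∈ A, leader f = ↑u}

/-- `f` is partially reduced w.r.t. `g`: no proper derivative of the leader of `g` appears
in `f`. -/
def PartiallyReduced (f g : DiffPoly k m n) : Prop :=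
  ∀ u : Deriv m n, leader g = ↑u → ∀ v ∈ f.vars, ¬ IsProperDerivative v u

/-- `f` is algebraically reduced w.r.t. `g`: `deg_u f < deg_u g` for the leader `u` of `g`. -/
def AlgReduced (f g : DiffPoly k m n) : Prop :=
  ∀ u : Deriv m n, leader g = ↑u → f.degreeOf u < g.degreeOf u

/-- A subset of `k{Y} \ k` is autoreduced if each element is (partially and algebraically)
reduced w.r.t. all the others. -/
def Autoreduced (A : Set (DiffPoly k m n)) : Prop :=
  (∀ f ∈ A, leader f ≠ ⊥) ∧
    ∀ f ∈ A, ∀ g ∈ A, f ≠ g → PartiallyReduced f g ∧ AlgReduced f g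

/-- A subset of `k{Y} \ k` is algebraically autoreduced if each element is algebraically
reduced w.r.t. all the others. -/
def AlgAutoreduced (A : Set (DiffPoly k m n)) : Prop :=
  (∀ f ∈ A, leader f ≠ ⊥) ∧ ∀ f ∈ A, ∀ g ∈ A, f ≠ g → AlgReduced f g

/-- A subset of `k{Y} \ k` is weak d-triangular if its elements have distinct leaders and the
set of these leaders is autoreduced, i.e. no leader is a derivative of the leader of another
element. -/
def WeakDTriangular (A : Set (DiffPoly k m n)) : Prop :=
  (∀ f ∈ A, leader f ≠ ⊥) ∧
    ∀ f ∈ A, ∀ g ∈ A, f ≠ g → ∀ u v : Deriv m n, leader f = ↑u → leader g = ↑v →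
      ∀ θ : Fin m →₀ ℕ, u ≠ act θ v

/-- `A` has lower rank than `B`: some `f ∈ A` has a rank that is not the rank of an element of
`B`, while below it the sets `A` and `B` have the same ranks.

For finite sets `A = A₁, …, A_r` and `B = B₁, …, B_s`, listed by strictly increasing rank, this
says that either there is `j ≤ r, s` with `rk A_i = rk B_i` for `i < j` and `rk A_j < rk B_j`, or
`r > s` and `rk A_i = rk B_i` for all `i ≤ s`: the polynomial `f` is `A_j` in the first case and
`A_(s+1)` in the second.  The present form makes sense for infinite sets too; algebraically
autoreduced sets may be infinite. -/
def LowerRank (A B : Set (DiffPoly k m n)) : Prop :=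
  ∃ f ∈ A, rk f ∉ rk '' B ∧ ∀ ρ < rk f, (ρ ∈ rk '' A ↔ ρ ∈ rk '' B)

/-- A (differential) characteristic set of `X`: an autoreduced subset of `X` of the lowest
rank. -/
def IsCharSet (X A : Set (DiffPoly k m n)) : Prop :=
  A ⊆ X ∧ Autoreduced A ∧ ∀ B ⊆ X, Autoreduced B → ¬ LowerRank B A

/-- An algebraic characteristic set of `X`: an algebraically autoreduced subset of `X` of the
lowest rank. -/
def IsAlgCharSet (X A : Set (DiffPoly k m n)) : Prop :=
  A ⊆ X ∧ AlgAutoreduced A ∧ ∀ B ⊆ X, AlgAutoreduced B → ¬ LowerRank B A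

/-- `f` is monic: the coefficient of its leading monomial is `1`, for the lexicographic order of
monomials that is induced by the ranking (two distinct monomials are compared by their exponents
at the highest derivative at which these differ). -/
def Monic (f : DiffPoly k m n) : Prop :=
  ∃ s ∈ f.support, f.coeff s = 1 ∧
    ∀ t ∈ f.support, t ≠ s → ∃ v, t v < s v ∧ ∀ w, v < w → t w = s w

/-- The requirements of canonicity, relative to a set `N` of non-leaders: for each element of
`A`, the initial lies in `k[N]`, the polynomial is monic, and it has no factors in `k[N] \ k`. -/
def CanonicalOver (N : Set (Deriv m n)) (A : Set (DiffPoly k m n)) : Prop :=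
  ∀ f ∈ A,
    (∀ u : Deriv m n, leader f = ↑u → topCoeff f u ∈ supported k N) ∧
    Monic f ∧
    ∀ p ∈ supported k N, p ∣ f → leader p = ⊥

/-- `A` is the canonical characteristic set of `X`; the set of non-leaders is
`ΘY \ Θ(ld A)`. -/
def IsCanonicalCharSet (X A : Set (DiffPoly k m n)) : Prop :=
  IsCharSet X A ∧ CanonicalOver (derivsOf (leaders A))ᶜ A

/-- `A` is the canonical algebraic characteristic set of a subset `X` of `k[V]`; the set of
non-leaders is `V \ ld A`. -/
def IsCanonicalAlgCharSet (V : Set (Deriv m n)) (X A : Set (DiffPoly k m n)) : Prop :=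
  IsAlgCharSet X A ∧ CanonicalOver (V \ leaders A) A

/-- `T` is a weak d-triangular subset of `A` of the least rank. -/
def IsLeastWeakDTriangularSubset (A T : Set (DiffPoly k m n)) : Prop :=
  T ⊆ A ∧ WeakDTriangular T ∧ ∀ T' ⊆ A, WeakDTriangular T' → ¬ LowerRank T' T

end Ranked

end DiffAlg

end

/-!
Call `v ∈ V` a leader if it is algebraic modulo `I` over the smaller elements of `V`; the remaining
elements `N` of `V` are algebraically independent modulo `I`, and all of `V` is algebraic over them.
Hence a coefficient outside `I` divides a polynomial in `N` modulo `I`, and each leader has a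
relation of minimal degree whose initial lies in `k[N]` and which is in normal form with respect to
the other leaders. No nonzero element of `I ∩ k[V]` is in normal form, so two such relations for the
same leader are proportional over `k[N]`, and exactly one of them is monic and has no factors in
`k[N] \ k`. These relations form `𝔻`.

As the characteristic is `0`, the separant of an element of `ℂ` is not in `I`, so differentiation
shows that each proper derivative of its leader has a relation of degree one modulo `I`. A minimal
relation whose leader is not a derivative of an element of `ld ℂ` would therefore be reduced with
respect to `ℂ`. So the leaders of `V` lie in `Θ ld ℂ`, and it follows that each element of `ℂ`
satisfies the conditions that characterize the element of `𝔻` with the same leader. At the first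
difference in rank, a weak d-triangular subset of `𝔻` that is lower than `ℂ` would contain a proper
derivative of a leader that it already has.
-/

noncomputable section

namespace DiffAlg

open MvPolynomial

section Polynomial

variable {σ R : Type*} [CommRing R] {i : σ} {f g r : MvPolynomial σ R} {W : Set σ} {d : ℕ}

theorem degreeOf_eq_zero_of_mem_supported (hf : f ∈ supported R W) (hi : i ∉ W) :
    f.degreeOf i = 0 := by
  by_contra h
  exact hi (mem_supported.1 hf (mem_vars_iff_degreeOf_ne_zero.2 h))

theorem mem_supported_of_degreeOf_le (h : ∀ j, f.degreeOf j ≤ g.degreeOf j)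
    (hg : g ∈ supported R W) : f ∈ supported R W := by
  refine mem_supported.2 fun j hj => mem_supported.1 hg ?_
  rw [Finset.mem_coe, mem_vars_iff_degreeOf_ne_zero] at hj ⊢
  exact (hj.bot_lt.trans_le (h j)).ne'

theorem degreeOf_le_of_dvd [NoZeroDivisors R] (h : f ∣ g) (hg : g ≠ 0) (j : σ) :
    f.degreeOf j ≤ g.degreeOf j := by
  obtain ⟨q, rfl⟩ := h
  rw [degreeOf_mul_eq (left_ne_zero_of_mul hg) (right_ne_zero_of_mul hg)]
  exact Nat.le_add_right _ _

theorem degreeOf_mul_le_of_degreeOf_eq_zero (hf : f.degreeOf i = 0) :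
    (f * g).degreeOf i ≤ g.degreeOf i := by
  simpa only [hf, zero_add] using degreeOf_mul_le i f g

theorem monomial_eq_erase_mul_X_pow (s : σ →₀ ℕ) (c : R) (i : σ) :
    monomial s c = monomial (s.erase i) c * X i ^ s i := by
  rw [X_pow_eq_monomial, monomial_mul, mul_one, Finsupp.erase_add_single]

theorem monomial_erase_mem_supported (hf : f ∈ supported R (insert i W)) {s : σ →₀ ℕ}
    (hs : s ∈ f.support) (c : R) : monomial (s.erase i) c ∈ supported R W := by
  classical
  refine mem_supported.2 fun j hj => ?_
  obtain ⟨t, ht, hjt⟩ := (mem_vars_iff_mem_support j).1 hj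
  obtain rfl := Finset.mem_singleton.1 (support_monomial_subset ht)
  rw [Finsupp.support_erase, Finset.mem_erase] at hjt
  exact (mem_supported.1 hf ((mem_vars_iff_mem_support j).2 ⟨s, hs, hjt.2⟩)).resolve_left hjt.1

theorem erase_add_single_of_eq_zero {s : σ →₀ ℕ} (hs : s i = 0) (d : ℕ) :
    (s + Finsupp.single i d).erase i = s := by
  rw [Finsupp.erase_add, Finsupp.erase_single, add_zero, Finsupp.erase_of_notMem_support]
  exact Finsupp.notMem_support_iff.2 hs

theorem coeff_mul_X_pow_of_degreeOf_eq_zero (hg : g.degreeOf i = 0) (d : ℕ) (t : σ →₀ ℕ) :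
    (g * X i ^ d).coeff t = if t i = d then g.coeff (t.erase i) else 0 := by
  classical
  rw [X_pow_eq_monomial, coeff_mul_monomial', mul_one]
  by_cases h : t i = d
  · rw [if_pos h, if_pos (Finsupp.single_le_iff.2 h.ge), ← h]
    congr 1
    exact tsub_eq_of_eq_add (Finsupp.erase_add_single i t).symm
  · rw [if_neg h, ite_eq_right_iff, Finsupp.single_le_iff]
    intro hle
    refine notMem_support_iff.1 (notMem_support_of_degreeOf_lt i ?_)
    rw [Finsupp.tsub_apply, Finsupp.single_eq_same]
    omega

theorem degreeOf_mul_X_pow_add (hg0 : g ≠ 0) (hg : g.degreeOf i = 0) (hr : r.degreeOf i < d) :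
    (g * X i ^ d + r).degreeOf i = d := by
  have h : (g * X i ^ d).degreeOf i = d := by
    rw [degreeOf_mul_X_self_pow_eq_add_of_ne_zero _ _ hg0, hg, zero_add]
  rw [degreeOf_add_eq_of_degreeOf_lt (by rwa [h]), h]

theorem add_single_mem_support_of_mem_support_pderiv {t : σ →₀ ℕ}
    (ht : t ∈ (pderiv i f).support) : t + Finsupp.single i 1 ∈ f.support := by
  rw [mem_support_iff, coeff_pderiv] at ht
  exact mem_support_iff.2 (left_ne_zero_of_mul ht)

theorem degreeOf_pderiv_le (f : MvPolynomial σ R) (i j : σ) :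
    (pderiv i f).degreeOf j ≤ f.degreeOf j := by
  refine degreeOf_le_iff.2 fun t ht => ?_
  have := monomial_le_degreeOf j (add_single_mem_support_of_mem_support_pderiv ht)
  rw [Finsupp.add_apply] at this
  omega

theorem degreeOf_pderiv_lt (hi : f.degreeOf i ≠ 0) :
    (pderiv i f).degreeOf i < f.degreeOf i := by
  refine (degreeOf_lt_iff (Nat.pos_of_ne_zero hi)).2 fun t ht => ?_
  have := monomial_le_degreeOf i (add_single_mem_support_of_mem_support_pderiv ht)
  rw [Finsupp.add_apply, Finsupp.single_eq_same] at this
  omega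

theorem pderiv_ne_zero [NoZeroDivisors R] [CharZero R] (hi : i ∈ f.vars) : pderiv i f ≠ 0 := by
  obtain ⟨s, hs, hsi⟩ := (mem_vars_iff_mem_support i).1 hi
  intro h
  have hcoeff : (pderiv i f).coeff (s - Finsupp.single i 1) = 0 := by rw [h, coeff_zero]
  rw [coeff_pderiv, Finsupp.sub_add_single_one_cancel (Finsupp.mem_support_iff.1 hsi)] at hcoeff
  exact (mul_eq_zero.1 hcoeff).elim (mem_support_iff.1 hs) (Nat.cast_add_one_ne_zero _)

theorem mkDerivation_eq_sum_pderiv (D : σ → MvPolynomial σ R) (f : MvPolynomial σ R) :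
    mkDerivation R D f = ∑ j ∈ f.vars, pderiv j f * D j := by
  classical
  let E : Derivation R (MvPolynomial σ R) (MvPolynomial σ R) := ∑ j ∈ f.vars, D j • pderiv j
  have hE : ∀ g, E g = ∑ j ∈ f.vars, pderiv j g * D j := fun g => by
    simp only [E]
    rw [← Derivation.coeFnAddMonoidHom_apply, map_sum, Finset.sum_apply]
    refine Finset.sum_congr rfl fun j _ => ?_
    rw [Derivation.coeFnAddMonoidHom_apply, Derivation.smul_apply, smul_eq_mul, mul_comm]
  rw [← hE]
  refine derivation_eq_of_forall_mem_vars fun i hi => ?_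
  rw [hE, mkDerivation_X, Finset.sum_eq_single i]
  · rw [pderiv_X_self, one_mul]
  · exact fun j _ hj => by rw [pderiv_X_of_ne hj.symm, zero_mul]
  · exact fun h => absurd hi h

end Polynomial

section TopCoeff

variable {k : Type*} [Field k] {m n : ℕ} {f g r : DiffPoly k m n} {u : Deriv m n}

theorem coeff_topCoeff (f : DiffPoly k m n) (u : Deriv m n) (t : Deriv m n →₀ ℕ) :
    (topCoeff f u).coeff t =
      if t u = 0 then f.coeff (t + Finsupp.single u (f.degreeOf u)) else 0 := by
  classical
  rw [topCoeff, coeff_sum]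
  simp only [coeff_monomial]
  split_ifs with h
  · have herase := erase_add_single_of_eq_zero h (f.degreeOf u)
    rw [Finset.sum_eq_single (t + Finsupp.single u (f.degreeOf u)), if_pos herase]
    · rintro s hs hne
      refine if_neg fun hst => hne ?_
      rw [← hst, ← (Finset.mem_filter.1 hs).2, Finsupp.erase_add_single]
    · intro hs
      rw [if_pos herase]
      by_contra h0
      exact hs (Finset.mem_filter.2 ⟨mem_support_iff.2 h0, by simp [h]⟩)
  · refine Finset.sum_eq_zero fun s _ => if_neg ?_
    rintro rfl
    exact h Finsupp.erase_same

theorem degreeOf_topCoeff_le (f : DiffPoly k m n) (u l : Deriv m n) :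
    (topCoeff f u).degreeOf l ≤ f.degreeOf l := by
  refine degreeOf_le_iff.2 fun t ht => ?_
  rw [mem_support_iff, coeff_topCoeff, ite_ne_right_iff] at ht
  refine le_trans ?_ (monomial_le_degreeOf l (mem_support_iff.2 ht.2))
  exact Nat.le_add_right _ _

theorem degreeOf_topCoeff_self (f : DiffPoly k m n) (u : Deriv m n) :
    (topCoeff f u).degreeOf u = 0 := by
  refine Nat.le_zero.1 (degreeOf_le_iff.2 fun t ht => ?_)
  rw [mem_support_iff, coeff_topCoeff, ite_ne_right_iff] at ht
  exact ht.1.le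

theorem topCoeff_ne_zero (hf : f ≠ 0) (u : Deriv m n) : topCoeff f u ≠ 0 := by
  obtain ⟨s, hs, hsu⟩ :=
    Finset.exists_mem_eq_sup f.support (support_nonempty.2 hf) (fun s => s u)
  rw [← degreeOf_eq_sup] at hsu
  intro h
  have hcoeff := coeff_topCoeff f u (s.erase u)
  rw [h, coeff_zero, if_pos Finsupp.erase_same, hsu, Finsupp.erase_add_single] at hcoeff
  exact mem_support_iff.1 hs hcoeff.symm

/-- The part of `f` that is left when the terms of highest degree in `u` are removed. -/
def tail (f : DiffPoly k m n) (u : Deriv m n) : DiffPoly k m n :=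
  f - topCoeff f u * X u ^ f.degreeOf u

theorem topCoeff_mul_X_pow_add_tail (f : DiffPoly k m n) (u : Deriv m n) :
    topCoeff f u * X u ^ f.degreeOf u + tail f u = f :=
  add_sub_cancel _ _

theorem coeff_tail (f : DiffPoly k m n) (u : Deriv m n) (t : Deriv m n →₀ ℕ) :
    (tail f u).coeff t = if t u = f.degreeOf u then 0 else f.coeff t := by
  rw [tail, coeff_sub, coeff_mul_X_pow_of_degreeOf_eq_zero (degreeOf_topCoeff_self f u)]
  split_ifs with h
  · rw [coeff_topCoeff, if_pos Finsupp.erase_same, ← h, Finsupp.erase_add_single, sub_self]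
  · rw [sub_zero]

theorem degreeOf_tail_le (f : DiffPoly k m n) (u l : Deriv m n) :
    (tail f u).degreeOf l ≤ f.degreeOf l := by
  refine degreeOf_le_iff.2 fun t ht => ?_
  rw [mem_support_iff, coeff_tail, ite_ne_left_iff] at ht
  exact monomial_le_degreeOf l (mem_support_iff.2 ht.2.symm)

theorem degreeOf_tail_lt (hu : f.degreeOf u ≠ 0) : (tail f u).degreeOf u < f.degreeOf u := by
  refine (degreeOf_lt_iff (Nat.pos_of_ne_zero hu)).2 fun t ht => ?_
  rw [mem_support_iff, coeff_tail, ite_ne_left_iff] at ht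
  exact lt_of_le_of_ne (monomial_le_degreeOf u (mem_support_iff.2 ht.2.symm)) ht.1

theorem topCoeff_mul_X_pow_add {d : ℕ} (hg0 : g ≠ 0) (hg : g.degreeOf u = 0)
    (hr : r.degreeOf u < d) : topCoeff (g * X u ^ d + r) u = g := by
  ext t
  rw [coeff_topCoeff, degreeOf_mul_X_pow_add hg0 hg hr]
  split_ifs with h
  · rw [coeff_add, coeff_mul_X_pow_of_degreeOf_eq_zero hg, if_pos (by simp [h]),
      notMem_support_iff.1 (notMem_support_of_degreeOf_lt u (p := r) (by simpa [h] using hr)),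
      add_zero, erase_add_single_of_eq_zero h]
  · exact (notMem_support_iff.1 (notMem_support_of_degreeOf_lt u (hg ▸ Nat.pos_of_ne_zero h))).symm

theorem topCoeff_mul_of_degreeOf_eq_zero (hg0 : g ≠ 0) (hg : g.degreeOf u = 0)
    (hf : f.degreeOf u ≠ 0) : topCoeff (g * f) u = g * topCoeff f u := by
  have hf0 : f ≠ 0 := by rintro rfl; exact hf (degreeOf_zero u)
  conv_lhs => rw [← topCoeff_mul_X_pow_add_tail f u, mul_add, ← mul_assoc]
  apply topCoeff_mul_X_pow_add (mul_ne_zero hg0 (topCoeff_ne_zero hf0 u))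
  · exact Nat.le_zero.1 ((degreeOf_mul_le_of_degreeOf_eq_zero hg).trans
      (degreeOf_topCoeff_self f u).le)
  · exact (degreeOf_mul_le_of_degreeOf_eq_zero hg).trans_lt (degreeOf_tail_lt hf)

end TopCoeff

section Leader

variable {k : Type*} [Field k] {m n : ℕ} [LinearOrder (Deriv m n)]
variable {f g r : DiffPoly k m n} {u v : Deriv m n} {V : Set (Deriv m n)}

theorem leader_eq_bot_iff : leader f = ⊥ ↔ f.vars = ∅ :=
  Finset.max_eq_bot

theorem leader_eq_coe_iff : leader f = ↑u ↔ u ∈ f.vars ∧ ∀ v ∈ f.vars, v ≤ u := by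
  refine ⟨fun h => ⟨Finset.mem_of_max h, fun v hv => Finset.le_max_of_eq hv h⟩, fun h => ?_⟩
  exact le_antisymm (Finset.max_le fun v hv => WithBot.coe_le_coe.2 (h.2 v hv))
    (Finset.le_max h.1)

theorem leader_unique (hu : leader f = ↑u) (hv : leader f = ↑v) : u = v :=
  WithBot.coe_injective (hu.symm.trans hv)

theorem exists_leader_eq_coe (h : leader f ≠ ⊥) : ∃ u : Deriv m n, leader f = ↑u :=
  (WithBot.ne_bot_iff_exists.1 h).imp fun _ => Eq.symm

theorem degreeOf_pos_of_leader_eq (hf : leader f = ↑u) : 0 < f.degreeOf u :=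
  Nat.pos_of_ne_zero (mem_vars_iff_degreeOf_ne_zero.1 (leader_eq_coe_iff.1 hf).1)

theorem ne_zero_of_leader_eq (hf : leader f = ↑u) : f ≠ 0 := by
  rintro rfl
  exact (degreeOf_pos_of_leader_eq hf).ne' (degreeOf_zero u)

theorem isUnit_of_leader_eq_bot (h : leader f = ⊥) (hf : f ≠ 0) : IsUnit f := by
  rw [vars_eq_empty_iff_eq_C.1 (leader_eq_bot_iff.1 h)] at hf ⊢
  exact (isUnit_iff_ne_zero.2 fun h0 => hf (by rw [h0, C_0])).map C

theorem leader_ne_bot_of_mem {I : Ideal (DiffPoly k m n)} (hI : I ≠ ⊤) (hf : f ∈ I)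
    (hf0 : f ≠ 0) : leader f ≠ ⊥ :=
  fun h => hI (I.eq_top_of_isUnit_mem hf (isUnit_of_leader_eq_bot h hf0))

theorem degreeOf_eq_zero_of_leader_lt (hf : leader f < ↑u) : f.degreeOf u = 0 := by
  by_contra h
  exact hf.not_ge (Finset.le_max (mem_vars_iff_degreeOf_ne_zero.2 h))

theorem mem_supported_insert_of_leader_eq (hf : f ∈ supported k V) (hu : leader f = ↑u) :
    f ∈ supported k (insert u (V ∩ Set.Iio u)) :=
  mem_supported.2 fun l hl => ((leader_eq_coe_iff.1 hu).2 l hl).eq_or_lt.imp_right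
    fun h => ⟨mem_supported.1 hf hl, h⟩

theorem topCoeff_mem_supported_of_leader_eq (hf : f ∈ supported k V) (hu : leader f = ↑u) :
    topCoeff f u ∈ supported k (V ∩ Set.Iio u) := by
  have hsupp := mem_supported_of_degreeOf_le (degreeOf_topCoeff_le f u)
    (mem_supported_insert_of_leader_eq hf hu)
  refine mem_supported.2 fun l hl => (mem_supported.1 hsupp hl).resolve_left ?_
  rintro rfl
  exact mem_vars_iff_degreeOf_ne_zero.1 hl (degreeOf_topCoeff_self f l)

theorem leader_eq_of_degreeOf_le (hg : leader g = ↑u) (h : ∀ l, f.degreeOf l ≤ g.degreeOf l)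
    (hu : f.degreeOf u ≠ 0) : leader f = ↑u := by
  refine leader_eq_coe_iff.2 ⟨mem_vars_iff_degreeOf_ne_zero.2 hu, fun l hl => ?_⟩
  refine (leader_eq_coe_iff.1 hg).2 l (mem_vars_iff_degreeOf_ne_zero.2 ?_)
  exact ((mem_vars_iff_degreeOf_ne_zero.1 hl).bot_lt.trans_le (h l)).ne'

theorem leader_mul_X_pow_add {d : ℕ} (hg0 : g ≠ 0) (hg : g ∈ supported k (Set.Iio u))
    (hr : r ∈ supported k (Set.Iic u)) (hrd : r.degreeOf u < d) :
    leader (g * X u ^ d + r) = ↑u := by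
  have hsupp : g * X u ^ d + r ∈ supported k (Set.Iic u) :=
    add_mem (mul_mem (supported_mono Set.Iio_subset_Iic_self hg)
      (pow_mem (X_mem_supported.2 Set.self_mem_Iic) d)) hr
  refine leader_eq_coe_iff.2 ⟨mem_vars_iff_degreeOf_ne_zero.2 ?_, mem_supported.1 hsupp⟩
  rw [degreeOf_mul_X_pow_add hg0 (degreeOf_eq_zero_of_mem_supported hg Set.self_notMem_Iio) hrd]
  exact hrd.ne_bot

end Leader

section Rank

variable {k : Type*} [Field k] {m n : ℕ} [LinearOrder (Deriv m n)]
variable {f g g' : DiffPoly k m n} {u v : Deriv m n} {A B : Set (DiffPoly k m n)}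

theorem rk_eq_coe (hf : leader f = ↑u) : rk f = ↑(toLex (u, f.degreeOf u)) := by
  rw [rk, hf, WithBot.map_coe]

theorem leader_eq_map_rk (f : DiffPoly k m n) : leader f = (rk f).map fun ρ => (ofLex ρ).1 := by
  rw [rk, WithBot.map_map]
  exact (congrFun WithBot.map_id _).symm

theorem leader_eq_of_rk_eq (h : rk f = rk g) : leader f = leader g := by
  rw [leader_eq_map_rk, h, leader_eq_map_rk]

theorem degreeOf_eq_of_rk_eq (h : rk f = rk g) (hf : leader f = ↑u) :
    f.degreeOf u = g.degreeOf u := by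
  have hg : leader g = ↑u := (leader_eq_of_rk_eq h).symm.trans hf
  rw [rk_eq_coe hf, rk_eq_coe hg] at h
  exact congrArg (fun ρ => (ofLex ρ).2) (WithBot.coe_injective h)

theorem rk_lt_rk_iff (hf : leader f = ↑u) (hg : leader g = ↑v) :
    rk f < rk g ↔ u < v ∨ u = v ∧ f.degreeOf u < g.degreeOf v := by
  rw [rk_eq_coe hf, rk_eq_coe hg, WithBot.coe_lt_coe, Prod.Lex.toLex_lt_toLex]

theorem leader_le_of_rk_lt (h : rk f < rk g) : leader f ≤ leader g := by
  rw [leader_eq_map_rk f, leader_eq_map_rk g]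
  exact WithBot.monotone_map_iff.2 Prod.Lex.monotone_fst_ofLex h.le

theorem leaders_eq_of_image_rk_eq (h : rk '' A = rk '' B) : leaders A = leaders B := by
  have hleaders (S : Set (DiffPoly k m n)) :
      leaders S = {u : Deriv m n | ∃ ρ ∈ rk '' S, ρ.map (fun ρ => (ofLex ρ).1) = ↑u} := by
    ext u
    simp only [leaders, Set.mem_ofPred_eq, Set.exists_mem_image, leader_eq_map_rk]
  rw [hleaders, hleaders, h]

theorem AlgReduced.congr_rk (hfg : AlgReduced f g) (h : rk g = rk g') : AlgReduced f g' := by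
  intro u hu
  have hgu := (leader_eq_of_rk_eq h).trans hu
  exact degreeOf_eq_of_rk_eq h hgu ▸ hfg u hgu

theorem AlgReduced.of_rk_lt (h : rk f < rk g) : AlgReduced f g := by
  intro v hv
  have hpos := degreeOf_pos_of_leader_eq hv
  by_cases hf : leader f = ↑v
  · exact (((rk_lt_rk_iff hf hv).1 h).resolve_left (lt_irrefl v)).2
  · rwa [degreeOf_eq_zero_of_leader_lt (hv ▸ (leader_le_of_rk_lt h).lt_of_ne (hv ▸ hf))]

theorem AlgReduced.rk_ne (h : AlgReduced f g) (hg : leader g ≠ ⊥) : rk f ≠ rk g := by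
  intro hrk
  obtain ⟨u, hu⟩ := exists_leader_eq_coe hg
  exact (h u hu).ne (degreeOf_eq_of_rk_eq hrk ((leader_eq_of_rk_eq hrk).trans hu))

theorem Autoreduced.algAutoreduced (hA : Autoreduced A) : AlgAutoreduced A :=
  ⟨hA.1, fun f hf g hg hfg => (hA.2 f hf g hg hfg).2⟩

theorem AlgAutoreduced.injOn_leader (hA : AlgAutoreduced A) : A.InjOn leader := by
  intro f hf g hg hfg
  by_contra hne
  obtain ⟨u, hu⟩ := exists_leader_eq_coe (hA.1 g hg)
  exact lt_asymm (hA.2 f hf g hg hne u hu) (hA.2 g hg f hf (Ne.symm hne) u (hfg.trans hu))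

theorem injOn_rk_of_injOn_leader (hA : A.InjOn leader) : A.InjOn rk :=
  fun _ hf _ hg h => hA hf hg (leader_eq_of_rk_eq h)

theorem LowerRank.exists_algReduced (hA : AlgAutoreduced A) (h : LowerRank A B) :
    ∃ f ∈ A, ∀ g ∈ B, AlgReduced f g := by
  obtain ⟨f, hf, hfB, hlow⟩ := h
  refine ⟨f, hf, fun g hg => ?_⟩
  rcases lt_trichotomy (rk f) (rk g) with hlt | heq | hgt
  · exact .of_rk_lt hlt
  · exact absurd ⟨g, hg, heq.symm⟩ hfB
  · obtain ⟨h, hh, hrk⟩ := (hlow _ hgt).2 ⟨g, hg, rfl⟩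
    refine (hA.2 f hf h hh ?_).congr_rk hrk
    rintro rfl
    exact hgt.ne' hrk

theorem image_rk_eq_of_not_lowerRank [WellFoundedLT (Deriv m n)] (hAB : ¬ LowerRank A B)
    (hBA : ¬ LowerRank B A) : rk '' A = rk '' B := by
  ext ρ
  induction ρ using WellFoundedLT.induction with
  | _ ρ ih =>
    constructor
    · rintro ⟨f, hf, rfl⟩
      by_contra hfB
      exact hAB ⟨f, hf, hfB, ih⟩
    · rintro ⟨g, hg, rfl⟩
      by_contra hgA
      exact hBA ⟨g, hg, hgA, fun σ hσ => (ih σ hσ).symm⟩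

theorem lowerRank_insert_rk_lt (hf : rk f ∉ rk '' A) :
    LowerRank (insert f {g ∈ A | rk g < rk f}) A := by
  refine ⟨f, Set.mem_insert _ _, hf, fun ρ hρ => ⟨?_, ?_⟩⟩
  · rintro ⟨g, rfl | hg, rfl⟩
    · exact absurd hρ (lt_irrefl _)
    · exact ⟨g, hg.1, rfl⟩
  · rintro ⟨g, hg, rfl⟩
    exact ⟨g, Or.inr ⟨hg, hρ⟩, rfl⟩

end Rank

section Relation

variable {k : Type*} [Field k] {m n : ℕ} [LinearOrder (Deriv m n)]
variable {I : Ideal (DiffPoly k m n)} {V V' : Set (Deriv m n)} {v : Deriv m n}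
variable {f g p r : DiffPoly k m n} {d : ℕ}

/-- An element of `I ∩ k[V]` with leader `v` whose initial does not lie in `I`: it witnesses that
`v` is algebraic modulo `I` over the smaller elements of `V`. -/
structure IsAlgRelation (I : Ideal (DiffPoly k m n)) (V : Set (Deriv m n)) (v : Deriv m n)
    (f : DiffPoly k m n) : Prop where
  mem : f ∈ I
  mem_supported : f ∈ supported k V
  leader_eq : leader f = ↑v
  topCoeff_notMem : topCoeff f v ∉ I

/-- The leaders of `V` modulo `I`: the elements of `V` that are algebraic modulo `I` over the
smaller elements of `V`. -/
def algLeaders (I : Ideal (DiffPoly k m n)) (V : Set (Deriv m n)) : Set (Deriv m n) :=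
  {v | ∃ f, IsAlgRelation I V v f}

/-- The degree of `v` modulo `I` over the smaller elements of `V`; it is `0` if `v` is not
a leader. -/
def leadDegree (I : Ideal (DiffPoly k m n)) (V : Set (Deriv m n)) (v : Deriv m n) : ℕ :=
  sInf {d | ∃ f, IsAlgRelation I V v f ∧ f.degreeOf v = d}

/-- `f` is in normal form modulo `I ∩ k[V]`: its degree in each leader `l` of `V` is less than the
degree of `l` modulo `I`. -/
def IsNormal (I : Ideal (DiffPoly k m n)) (V : Set (Deriv m n)) (f : DiffPoly k m n) : Prop :=
  ∀ l ∈ algLeaders I V, f.degreeOf l < leadDegree I V l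

theorem IsAlgRelation.mem_insert (h : IsAlgRelation I V v f) :
    f ∈ supported k (insert v (V ∩ Set.Iio v)) :=
  mem_supported_insert_of_leader_eq h.mem_supported h.leader_eq

theorem IsAlgRelation.mem_var (h : IsAlgRelation I V v f) : v ∈ V :=
  MvPolynomial.mem_supported.1 h.mem_supported (leader_eq_coe_iff.1 h.leader_eq).1

theorem IsAlgRelation.mono (hV : V ⊆ V') (h : IsAlgRelation I V v f) : IsAlgRelation I V' v f :=
  ⟨h.mem, supported_mono hV h.mem_supported, h.leader_eq, h.topCoeff_notMem⟩

theorem isAlgRelation_mul_X_pow_add (hv : v ∈ V) (hg : g ∈ supported k (V ∩ Set.Iio v))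
    (hgI : g ∉ I) (hr : r ∈ supported k (insert v (V ∩ Set.Iio v))) (hrd : r.degreeOf v < d)
    (hI : g * X v ^ d + r ∈ I) : IsAlgRelation I V v (g * X v ^ d + r) := by
  have hg0 : g ≠ 0 := fun h => hgI (h ▸ I.zero_mem)
  have hgv : g.degreeOf v = 0 := degreeOf_eq_zero_of_mem_supported hg fun h => lt_irrefl v h.2
  refine ⟨hI, add_mem (mul_mem (supported_mono Set.inter_subset_left hg)
    (pow_mem (X_mem_supported.2 hv) d)) (supported_mono ?_ hr),
    leader_mul_X_pow_add hg0 (supported_mono Set.inter_subset_right hg)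
      (supported_mono ?_ hr) hrd, ?_⟩
  · exact Set.insert_subset hv Set.inter_subset_left
  · exact Set.insert_subset Set.self_mem_Iic fun l hl => hl.2.le
  · rwa [topCoeff_mul_X_pow_add hg0 hgv hrd]

theorem algLeaders_mono (hV : V ⊆ V') : algLeaders I V ⊆ algLeaders I V' :=
  fun _ ⟨f, hf⟩ => ⟨f, hf.mono hV⟩

theorem IsAlgRelation.leadDegree_le (h : IsAlgRelation I V v f) :
    leadDegree I V v ≤ f.degreeOf v :=
  Nat.sInf_le ⟨f, h, rfl⟩

theorem exists_isAlgRelation_degreeOf_eq (hv : v ∈ algLeaders I V) :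
    ∃ f, IsAlgRelation I V v f ∧ f.degreeOf v = leadDegree I V v := by
  obtain ⟨f, hf⟩ := hv
  exact Nat.sInf_mem (s := {d | ∃ f, IsAlgRelation I V v f ∧ f.degreeOf v = d}) ⟨_, f, hf, rfl⟩

theorem leadDegree_pos (hv : v ∈ algLeaders I V) : 0 < leadDegree I V v := by
  obtain ⟨f, hf, hd⟩ := exists_isAlgRelation_degreeOf_eq hv
  exact hd ▸ degreeOf_pos_of_leader_eq hf.leader_eq

theorem leadDegree_anti (hV : V ⊆ V') (hv : v ∈ algLeaders I V) :
    leadDegree I V' v ≤ leadDegree I V v := by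
  obtain ⟨f, hf, hd⟩ := exists_isAlgRelation_degreeOf_eq hv
  exact hd ▸ (hf.mono hV).leadDegree_le

theorem IsNormal.of_degreeOf_le (hg : IsNormal I V g) (h : ∀ l, f.degreeOf l ≤ g.degreeOf l) :
    IsNormal I V f :=
  fun l hl => (h l).trans_lt (hg l hl)

theorem IsNormal.add (hf : IsNormal I V f) (hg : IsNormal I V g) : IsNormal I V (f + g) :=
  fun l hl => (degreeOf_add_le l f g).trans_lt (max_lt (hf l hl) (hg l hl))

theorem IsNormal.neg (hf : IsNormal I V f) : IsNormal I V (-f) :=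
  fun l hl => by rw [degreeOf_neg]; exact hf l hl

theorem IsNormal.mul_left (hp : p ∈ supported k (V' \ algLeaders I V)) (hf : IsNormal I V f) :
    IsNormal I V (p * f) := fun l hl =>
  (degreeOf_mul_le_of_degreeOf_eq_zero
    (degreeOf_eq_zero_of_mem_supported hp fun h => h.2 hl)).trans_lt (hf l hl)

theorem isNormal_of_mem_supported_sdiff (hp : p ∈ supported k (V' \ algLeaders I V)) :
    IsNormal I V p := fun l hl => by
  rw [degreeOf_eq_zero_of_mem_supported hp fun h => h.2 hl]
  exact leadDegree_pos hl

theorem IsNormal.eq_zero (hI : I ≠ ⊤) (hf : IsNormal I V f) (hfI : f ∈ I)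
    (hfV : f ∈ supported k V) : f = 0 := by
  induction h : f.vars.card using Nat.strong_induction_on generalizing f with
  | _ N ih =>
    by_contra hf0
    obtain ⟨v, hv⟩ := exists_leader_eq_coe (leader_ne_bot_of_mem hI hfI hf0)
    have htop : topCoeff f v ∉ I := by
      refine fun htop => topCoeff_ne_zero hf0 v (ih _ ?_ (hf.of_degreeOf_le
        (degreeOf_topCoeff_le f v)) htop (mem_supported_of_degreeOf_le
          (degreeOf_topCoeff_le f v) hfV) rfl)
      rw [← h]
      refine Finset.card_lt_card ((Finset.ssubset_iff_of_subset fun l hl => ?_).2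
        ⟨v, (leader_eq_coe_iff.1 hv).1, ?_⟩)
      · rw [mem_vars_iff_degreeOf_ne_zero] at hl ⊢
        exact (hl.bot_lt.trans_le (degreeOf_topCoeff_le f v l)).ne'
      · exact fun hl => mem_vars_iff_degreeOf_ne_zero.1 hl (degreeOf_topCoeff_self f v)
    have hrel : IsAlgRelation I V v f := ⟨hfI, hfV, hv, htop⟩
    exact (hf v ⟨f, hrel⟩).not_ge hrel.leadDegree_le

theorem notMem_of_mem_supported_sdiff (hI : I ≠ ⊤) (hp : p ∈ supported k (V \ algLeaders I V))
    (hp0 : p ≠ 0) : p ∉ I := fun h =>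
  hp0 ((isNormal_of_mem_supported_sdiff hp).eq_zero hI h (supported_mono Set.sdiff_subset hp))

end Relation

section Inversion

variable {σ k S : Type*} [Field k] [CommRing S] [IsDomain S] [Algebra k S]
variable {I : Ideal (MvPolynomial σ k)} {W W' : Set σ}

theorem exists_mul_mem_of_isAlgebraic {A B : Subalgebra k S} (hAB : A ≤ B) {x : S} (hx : x ∈ B)
    (hx0 : x ≠ 0) (halg : IsAlgebraic A x) : ∃ y ∈ B, x * y ∈ A ∧ x * y ≠ 0 := by
  let _ : Algebra A B := (Subalgebra.inclusion hAB).toAlgebra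
  let ι : B →ₐ[A] S := { B.val with commutes' := fun _ => rfl }
  have halgB : IsAlgebraic A (⟨x, hx⟩ : B) :=
    (isAlgebraic_algHom_iff ι Subtype.val_injective).1 halg
  obtain ⟨a, ha0, y, hy⟩ := halgB.exists_nonzero_dvd
    (mem_nonZeroDivisors_of_ne_zero fun h => hx0 (congrArg Subtype.val h))
  have hxy : (a : S) = x * y := congrArg Subtype.val hy
  exact ⟨y, y.2, hxy ▸ a.2, hxy ▸ fun h => ha0 (Subtype.ext h)⟩

/-- The subalgebra of `k[σ] / I` generated by the classes of the elements of `W`. -/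
def quotAdjoin (I : Ideal (MvPolynomial σ k)) (W : Set σ) :
    Subalgebra k (MvPolynomial σ k ⧸ I) :=
  Algebra.adjoin k ((fun i => Ideal.Quotient.mk I (X i)) '' W)

theorem mem_quotAdjoin_iff {a : MvPolynomial σ k ⧸ I} :
    a ∈ quotAdjoin I W ↔ ∃ g ∈ supported k W, Ideal.Quotient.mk I g = a := by
  have h : quotAdjoin I W = (supported k W).map (Ideal.Quotient.mkₐ k I) := by
    rw [supported_eq_adjoin_X, AlgHom.map_adjoin, Set.image_image]
    rfl
  rw [h, Subalgebra.mem_map]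
  rfl

theorem quotAdjoin_mono (h : W' ⊆ W) : quotAdjoin I W' ≤ quotAdjoin I W :=
  Algebra.adjoin_mono (Set.image_mono h)

variable [I.IsPrime]

theorem isAlgebraic_quotAdjoin_of_forall
    (h : ∀ i ∈ W, IsAlgebraic (quotAdjoin I W') (Ideal.Quotient.mk I (X i)))
    {a : MvPolynomial σ k ⧸ I} (ha : IsAlgebraic (quotAdjoin I W) a) :
    IsAlgebraic (quotAdjoin I W') a := by
  refine IsAlgebraic.adjoin_of_forall_isAlgebraic ?_ ha
  rintro _ ⟨⟨i, hi, rfl⟩, -⟩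
  exact h i hi

theorem isAlgebraic_of_mem_quotAdjoin {a : MvPolynomial σ k ⧸ I} (ha : a ∈ quotAdjoin I W) :
    IsAlgebraic (quotAdjoin I W) a :=
  isAlgebraic_algebraMap (A := MvPolynomial σ k ⧸ I) (⟨a, ha⟩ : quotAdjoin I W)

theorem exists_mul_sub_mem (hW : W' ⊆ W)
    (h : ∀ i ∈ W, IsAlgebraic (quotAdjoin I W') (Ideal.Quotient.mk I (X i)))
    {g : MvPolynomial σ k} (hg : g ∈ supported k W) (hgI : g ∉ I) :
    ∃ q ∈ supported k W, ∃ p ∈ supported k W', p ∉ I ∧ g * q - p ∈ I := by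
  have hgW : Ideal.Quotient.mk I g ∈ quotAdjoin I W := mem_quotAdjoin_iff.2 ⟨g, hg, rfl⟩
  obtain ⟨y, hyW, hyW', hy0⟩ := exists_mul_mem_of_isAlgebraic (quotAdjoin_mono hW) hgW
    (fun h0 => hgI (Ideal.Quotient.eq_zero_iff_mem.1 h0))
    (isAlgebraic_quotAdjoin_of_forall h (isAlgebraic_of_mem_quotAdjoin hgW))
  obtain ⟨q, hq, rfl⟩ := mem_quotAdjoin_iff.1 hyW
  obtain ⟨p, hp, hpq⟩ := mem_quotAdjoin_iff.1 hyW'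
  refine ⟨q, hq, p, hp, fun hpI => hy0 ?_, ?_⟩
  · rw [← hpq, Ideal.Quotient.eq_zero_iff_mem.2 hpI]
  · rw [← Ideal.Quotient.eq_zero_iff_mem, map_sub, map_mul, hpq, sub_self]

end Inversion

section Algebraicity

variable {k : Type*} [Field k] {m n : ℕ} {I : Ideal (DiffPoly k m n)}
variable {V W : Set (Deriv m n)} {v : Deriv m n} {f : DiffPoly k m n}

theorem isAlgebraic_mk_X (hf : f ∈ I) (hfW : f ∈ supported k (insert v W))
    (htop : topCoeff f v ∉ I) : IsAlgebraic (quotAdjoin I W) (Ideal.Quotient.mk I (X v)) := by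
  classical
  let a (s : f.support) : quotAdjoin I W :=
    ⟨Ideal.Quotient.mk I (monomial (s.1.erase v) (f.coeff s)),
      mem_quotAdjoin_iff.2 ⟨_, monomial_erase_mem_supported hfW s.2 _, rfl⟩⟩
  let P : Polynomial (quotAdjoin I W) := ∑ s, Polynomial.C (a s) * Polynomial.X ^ s.1 v
  have hcoeff : (P.coeff (f.degreeOf v) : DiffPoly k m n ⧸ I) =
      Ideal.Quotient.mk I (topCoeff f v) := by
    rw [topCoeff, Finset.sum_filter, ← Finset.sum_coe_sort f.support, map_sum]
    simp only [P, Polynomial.finsetSum_coeff, Polynomial.coeff_C_mul_X_pow,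
      AddSubmonoidClass.coe_finsetSum, eq_comm (a := f.degreeOf v)]
    refine Finset.sum_congr rfl fun s _ => ?_
    split_ifs
    · rfl
    · rw [map_zero, ZeroMemClass.coe_zero]
  have heval : Polynomial.aeval (Ideal.Quotient.mk I (X v)) P = Ideal.Quotient.mk I f := by
    conv_rhs => rw [f.as_sum, ← Finset.sum_coe_sort]
    simp only [P, map_sum, map_mul, map_pow, Polynomial.aeval_C, Polynomial.aeval_X]
    refine Finset.sum_congr rfl fun s _ => ?_
    rw [monomial_eq_erase_mul_X_pow s.1 _ v, map_mul, map_pow]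
    rfl
  refine ⟨P, fun hP => htop ?_, by rw [heval, Ideal.Quotient.eq_zero_iff_mem.2 hf]⟩
  rw [hP, Polynomial.coeff_zero] at hcoeff
  exact Ideal.Quotient.eq_zero_iff_mem.1 hcoeff.symm

variable [LinearOrder (Deriv m n)] [WellFoundedLT (Deriv m n)] [I.IsPrime]

theorem isAlgebraic_mk_X_over_nonleaders (hv : v ∈ V) :
    IsAlgebraic (quotAdjoin I (insert v (V ∩ Set.Iio v) \ algLeaders I V))
      (Ideal.Quotient.mk I (X v)) := by
  induction v using WellFoundedLT.induction with
  | _ v ih =>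
    by_cases hL : v ∈ algLeaders I V
    · obtain ⟨f, hf⟩ := hL
      refine isAlgebraic_quotAdjoin_of_forall (fun u hu => ?_)
        (isAlgebraic_mk_X hf.mem hf.mem_insert hf.topCoeff_notMem)
      refine isAlgebraic_quotAdjoin_of_forall (fun w hw => ?_) (ih u hu.2 hu.1)
      refine isAlgebraic_of_mem_quotAdjoin (mem_quotAdjoin_iff.2 ⟨X w, X_mem_supported.2 ?_, rfl⟩)
      refine ⟨Or.inr (hw.1.elim (fun h => h ▸ hu) fun h => ⟨h.1, h.2.trans hu.2⟩), hw.2⟩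
    · exact isAlgebraic_of_mem_quotAdjoin
        (mem_quotAdjoin_iff.2 ⟨X v, X_mem_supported.2 ⟨Set.mem_insert _ _, hL⟩, rfl⟩)

theorem isAlgebraic_mk_X_of_mem_Iio {u : Deriv m n} (hu : u ∈ V ∩ Set.Iio v) :
    IsAlgebraic (quotAdjoin I ((V ∩ Set.Iio v) \ algLeaders I V))
      (Ideal.Quotient.mk I (X u)) := by
  refine isAlgebraic_quotAdjoin_of_forall (fun w hw => ?_) (isAlgebraic_mk_X_over_nonleaders hu.1)
  refine isAlgebraic_of_mem_quotAdjoin (mem_quotAdjoin_iff.2 ⟨X w, X_mem_supported.2 ?_, rfl⟩)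
  exact ⟨hw.1.elim (fun h => h ▸ hu) fun h => ⟨h.1, h.2.trans hu.2⟩, hw.2⟩

theorem exists_isAlgRelation_topCoeff_mem (hv : v ∈ algLeaders I V) :
    ∃ f, IsAlgRelation I V v f ∧ f.degreeOf v = leadDegree I V v ∧
      topCoeff f v ∈ supported k ((V ∩ Set.Iio v) \ algLeaders I V) := by
  obtain ⟨f, hf, hfd⟩ := exists_isAlgRelation_degreeOf_eq hv
  have htop := topCoeff_mem_supported_of_leader_eq hf.mem_supported hf.leader_eq
  obtain ⟨q, hq, p, hp, hpI, hpq⟩ := exists_mul_sub_mem Set.sdiff_subset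
    (fun u hu => isAlgebraic_mk_X_of_mem_Iio hu) htop hf.topCoeff_notMem
  have hvW : v ∉ V ∩ Set.Iio v := fun h => lt_irrefl v h.2
  have hp' := supported_mono (R := k) Set.sdiff_subset hp
  have hpv := degreeOf_eq_zero_of_mem_supported hp' hvW
  have hrd : (q * tail f v).degreeOf v < f.degreeOf v :=
    (degreeOf_mul_le_of_degreeOf_eq_zero (degreeOf_eq_zero_of_mem_supported hq hvW)).trans_lt
      (degreeOf_tail_lt (degreeOf_pos_of_leader_eq hf.leader_eq).ne')
  have hrel : IsAlgRelation I V v (p * X v ^ f.degreeOf v + q * tail f v) := by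
    refine isAlgRelation_mul_X_pow_add hf.mem_var hp' hpI
      (mul_mem (supported_mono (Set.subset_insert _ _) hq)
        (mem_supported_of_degreeOf_le (degreeOf_tail_le f v) hf.mem_insert)) hrd ?_
    have heq : p * X v ^ f.degreeOf v + q * tail f v =
        q * f - X v ^ f.degreeOf v * (topCoeff f v * q - p) := by
      linear_combination q * topCoeff_mul_X_pow_add_tail f v
    rw [heq]
    exact sub_mem (I.mul_mem_left _ hf.mem) (I.mul_mem_left _ hpq)
  have hp0 : p ≠ 0 := fun h => hpI (h ▸ I.zero_mem)
  refine ⟨_, hrel, (degreeOf_mul_X_pow_add hp0 hpv hrd).trans hfd, ?_⟩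
  rwa [topCoeff_mul_X_pow_add hp0 hpv hrd]

end Algebraicity

section NormalForm

variable {k : Type*} [Field k] {m n : ℕ} [LinearOrder (Deriv m n)]
variable {I : Ideal (DiffPoly k m n)} {V W W' : Set (Deriv m n)} {v : Deriv m n}
variable {f g p : DiffPoly k m n}

/-- The polynomials `g` that have a normal form in `k[W]`: a multiple of `g` by a nonzero
polynomial in the non-leaders that lie in `W` is congruent modulo `I` to an element of `k[W]` in
normal form. -/
def normalizable (I : Ideal (DiffPoly k m n)) (V W : Set (Deriv m n)) :
    AddSubgroup (DiffPoly k m n) where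
  carrier := {g | ∃ q ∈ supported k (W \ algLeaders I V), q ≠ 0 ∧
    ∃ r ∈ supported k W, IsNormal I V r ∧ q * g - r ∈ I}
  zero_mem' := ⟨1, one_mem _, one_ne_zero, 0, zero_mem _,
    isNormal_of_mem_supported_sdiff (V' := ∅) (zero_mem _), by simp⟩
  add_mem' := by
    rintro f g ⟨p, hp, hp0, r, hr, hrn, hrI⟩ ⟨q, hq, hq0, s, hs, hsn, hsI⟩
    refine ⟨p * q, mul_mem hp hq, mul_ne_zero hp0 hq0, q * r + p * s,
      add_mem (mul_mem (supported_mono Set.sdiff_subset hq) hr)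
        (mul_mem (supported_mono Set.sdiff_subset hp) hs),
      (hrn.mul_left hq).add (hsn.mul_left hp), ?_⟩
    have heq : p * q * (f + g) - (q * r + p * s) = q * (p * f - r) + p * (q * g - s) := by ring
    exact heq ▸ add_mem (I.mul_mem_left _ hrI) (I.mul_mem_left _ hsI)
  neg_mem' := by
    rintro f ⟨q, hq, hq0, r, hr, hrn, hrI⟩
    refine ⟨q, hq, hq0, -r, neg_mem hr, hrn.neg, ?_⟩
    have heq : q * -f - -r = -(q * f - r) := by ring
    exact heq ▸ neg_mem hrI

theorem normalizable_mono (hW : W ⊆ W') : normalizable I V W ≤ normalizable I V W' := by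
  rintro g ⟨q, hq, hq0, r, hr, hrn, hrI⟩
  exact ⟨q, supported_mono (Set.sdiff_subset_sdiff_left hW) hq, hq0, r, supported_mono hW hr, hrn,
    hrI⟩

theorem mem_normalizable_of_mul_mem (hp : p ∈ supported k (W \ algLeaders I V)) (hp0 : p ≠ 0)
    (h : p * f ∈ normalizable I V W) : f ∈ normalizable I V W := by
  obtain ⟨q, hq, hq0, r, hr, hrn, hrI⟩ := h
  exact ⟨q * p, mul_mem hq hp, mul_ne_zero hq0 hp0, r, hr, hrn, by rwa [mul_assoc]⟩

theorem mem_normalizable_of_mem_ideal (hf : f ∈ I) : f ∈ normalizable I V W :=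
  ⟨1, one_mem _, one_ne_zero, 0, zero_mem _,
    isNormal_of_mem_supported_sdiff (V' := ∅) (zero_mem _), by simpa using hf⟩

theorem mul_X_pow_mem_normalizable (hg : g ∈ normalizable I V (V ∩ Set.Iio v)) {j : ℕ}
    (hj : v ∈ algLeaders I V → j < leadDegree I V v) :
    g * X v ^ j ∈ normalizable I V (insert v (V ∩ Set.Iio v)) := by
  obtain ⟨q, hq, hq0, r, hr, hrn, hrI⟩ := hg
  refine ⟨q, supported_mono (Set.sdiff_subset_sdiff_left (Set.subset_insert _ _)) hq, hq0,
    r * X v ^ j, mul_mem (supported_mono (Set.subset_insert _ _) hr)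
      (pow_mem (X_mem_supported.2 (Set.mem_insert _ _)) j), fun l hl => ?_, ?_⟩
  · by_cases hlv : l = v
    · subst hlv
      refine (degreeOf_mul_le_of_degreeOf_eq_zero (degreeOf_eq_zero_of_mem_supported hr fun h =>
        lt_irrefl l h.2)).trans_lt ?_
      rw [degreeOf_X_self_pow]
      exact hj hl
    · rw [degreeOf_mul_X_pow_of_ne _ hlv]
      exact hrn l hl
  · have heq : q * (g * X v ^ j) - r * X v ^ j = X v ^ j * (q * g - r) := by ring
    exact heq ▸ I.mul_mem_left _ hrI

variable [WellFoundedLT (Deriv m n)] [I.IsPrime]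

theorem supported_mul_X_pow_mem_normalizable
    (h : ∀ g ∈ supported k (V ∩ Set.Iio v), g ∈ normalizable I V (V ∩ Set.Iio v)) (j : ℕ)
    (hg : g ∈ supported k (V ∩ Set.Iio v)) :
    g * X v ^ j ∈ normalizable I V (insert v (V ∩ Set.Iio v)) := by
  induction j using Nat.strong_induction_on generalizing g with
  | _ j ih =>
    by_cases hj : v ∈ algLeaders I V → j < leadDegree I V v
    · exact mul_X_pow_mem_normalizable (h g hg) hj
    push Not at hj
    obtain ⟨hL, hdj⟩ := hj
    -- pseudo-division of `v ^ j` by a relation of minimal degree with initial in `k[N]`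
    obtain ⟨f, hf, hfd, htop⟩ := exists_isAlgRelation_topCoeff_mem hL
    rw [← hfd] at hdj
    have htail : tail f v * g * X v ^ (j - f.degreeOf v) ∈
        normalizable I V (insert v (V ∩ Set.Iio v)) := by
      rw [(tail f v).as_sum, Finset.sum_mul, Finset.sum_mul]
      refine sum_mem fun s hs => ?_
      have hsd : s v < f.degreeOf v := (monomial_le_degreeOf v hs).trans_lt
        (degreeOf_tail_lt (degreeOf_pos_of_leader_eq hf.leader_eq).ne')
      have hmem := mem_supported_of_degreeOf_le (degreeOf_tail_le f v) hf.mem_insert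
      rw [monomial_eq_erase_mul_X_pow s _ v, mul_right_comm _ _ g, mul_assoc, ← pow_add]
      exact ih _ (by omega) (mul_mem (monomial_erase_mem_supported hmem hs _) hg)
    refine mem_normalizable_of_mul_mem
      (supported_mono (Set.sdiff_subset_sdiff_left (Set.subset_insert _ _)) htop)
      (topCoeff_ne_zero (ne_zero_of_leader_eq hf.leader_eq) v) ?_
    have heq : topCoeff f v * (g * X v ^ j) =
        g * X v ^ (j - f.degreeOf v) * f - tail f v * g * X v ^ (j - f.degreeOf v) := by
      linear_combination g * X v ^ (j - f.degreeOf v) * topCoeff_mul_X_pow_add_tail f v -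
        topCoeff f v * g * pow_sub_mul_pow (X v : DiffPoly k m n) hdj
    exact heq ▸ sub_mem (mem_normalizable_of_mem_ideal (I.mul_mem_left _ hf.mem)) htail

theorem mem_normalizable_insert
    (h : ∀ g ∈ supported k (V ∩ Set.Iio v), g ∈ normalizable I V (V ∩ Set.Iio v))
    (hf : f ∈ supported k (insert v (V ∩ Set.Iio v))) :
    f ∈ normalizable I V (insert v (V ∩ Set.Iio v)) := by
  rw [f.as_sum]
  refine sum_mem fun s hs => ?_
  rw [monomial_eq_erase_mul_X_pow s _ v]
  exact supported_mul_X_pow_mem_normalizable h _ (monomial_erase_mem_supported hf hs _)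

theorem mem_normalizable_Iio (hf : f ∈ supported k (V ∩ Set.Iio v)) :
    f ∈ normalizable I V (V ∩ Set.Iio v) := by
  induction v using WellFoundedLT.induction generalizing f with
  | _ v ih =>
    rcases eq_or_ne (leader f) ⊥ with hbot | hbot
    · have hempty : f ∈ supported k (∅ \ algLeaders I V) := by
        rw [mem_supported, leader_eq_bot_iff.1 hbot]
        simp
      exact ⟨1, one_mem _, one_ne_zero, f, hf, isNormal_of_mem_supported_sdiff hempty, by simp⟩
    · obtain ⟨u, hu⟩ := exists_leader_eq_coe hbot
      have huv := mem_supported.1 hf (leader_eq_coe_iff.1 hu).1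
      refine normalizable_mono ?_ (mem_normalizable_insert (fun _ => ih u huv.2)
        (mem_supported_insert_of_leader_eq (supported_mono Set.inter_subset_left hf) hu))
      exact Set.insert_subset huv fun l hl => ⟨hl.1, hl.2.trans huv.2⟩

end NormalForm

section Monic

variable {k : Type*} [Field k] {m n : ℕ} {f : DiffPoly k m n} {s t : Deriv m n →₀ ℕ} {a : k}

/-- The exponent vector `s` as an element of the linear order of monomials that defines `Monic`;
Mathlib's lexicographic order compares at the least index first, hence the dual order. -/
def lexKey (s : Deriv m n →₀ ℕ) : Lex ((Deriv m n)ᵒᵈ →₀ ℕ) :=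
  toLex (s.equivMapDomain OrderDual.toDual)

theorem lexKey_injective : Function.Injective (lexKey : (Deriv m n →₀ ℕ) → _) :=
  toLex.injective.comp (Finsupp.equivCongrLeft OrderDual.toDual).injective

variable [LinearOrder (Deriv m n)]

theorem lexKey_lt_lexKey_iff :
    lexKey t < lexKey s ↔ ∃ v, t v < s v ∧ ∀ w, v < w → t w = s w := by
  rw [Finsupp.Lex.lt_iff]
  exact exists_congr fun _ => and_comm

theorem monic_iff : Monic f ↔
    ∃ s ∈ f.support, f.coeff s = 1 ∧ ∀ t ∈ f.support, lexKey t ≤ lexKey s := by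
  simp only [Monic, ← lexKey_lt_lexKey_iff, le_iff_lt_or_eq, lexKey_injective.eq_iff,
    or_iff_not_imp_right, ne_eq]

theorem Monic.eq_of_C_mul (hf : Monic f) (haf : Monic (C a * f)) : C a * f = f := by
  obtain ⟨s, hs, hs1, hsmax⟩ := monic_iff.1 hf
  obtain ⟨t, ht, ht1, htmax⟩ := monic_iff.1 haf
  have ha : a ≠ 0 := by
    rintro rfl
    simp at ht
  rw [← smul_eq_C_mul, support_smul_eq ha] at ht htmax
  obtain rfl := lexKey_injective ((hsmax t ht).antisymm (htmax s hs))
  rw [coeff_C_mul, hs1, mul_one] at ht1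
  rw [ht1, C_1, one_mul]

theorem exists_monic_C_mul (hf : f ≠ 0) : ∃ a : k, a ≠ 0 ∧ Monic (C a * f) := by
  obtain ⟨s, hs, hmax⟩ := Finset.exists_max_image f.support lexKey (support_nonempty.2 hf)
  have ha := inv_ne_zero (mem_support_iff.1 hs)
  refine ⟨(f.coeff s)⁻¹, ha, monic_iff.2 ⟨s, ?_, ?_, ?_⟩⟩
  · rwa [← smul_eq_C_mul, support_smul_eq ha]
  · rw [coeff_C_mul, inv_mul_cancel₀ (mem_support_iff.1 hs)]
  · rwa [← smul_eq_C_mul, support_smul_eq ha]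

end Monic

section CanonicalRelation

variable {k : Type*} [Field k] {m n : ℕ} [LinearOrder (Deriv m n)]
variable {I : Ideal (DiffPoly k m n)} {V : Set (Deriv m n)} {v : Deriv m n}
variable {f g q : DiffPoly k m n}

/-- A relation of minimal degree in its leader that is in normal form with respect to the other
leaders and whose initial is a polynomial in the non-leaders. -/
structure IsMinimalRelation (I : Ideal (DiffPoly k m n)) (V : Set (Deriv m n)) (v : Deriv m n)
    (f : DiffPoly k m n) : Prop extends IsAlgRelation I V v f where
  degreeOf_eq : f.degreeOf v = leadDegree I V v
  degreeOf_lt : ∀ l ∈ algLeaders I V, l ≠ v → f.degreeOf l < leadDegree I V l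
  topCoeff_mem : topCoeff f v ∈ supported k (V \ algLeaders I V)

/-- A minimal relation that is monic and primitive over the non-leaders. -/
structure IsCanonicalRelation (I : Ideal (DiffPoly k m n)) (V : Set (Deriv m n)) (v : Deriv m n)
    (f : DiffPoly k m n) : Prop extends IsMinimalRelation I V v f where
  monic : Monic f
  primitive : ∀ p ∈ supported k (V \ algLeaders I V), p ∣ f → leader p = ⊥

theorem IsAlgRelation.mem_algLeaders (h : IsAlgRelation I V v f) : v ∈ algLeaders I V :=
  ⟨f, h⟩

theorem IsAlgRelation.ne_zero (h : IsAlgRelation I V v f) : f ≠ 0 :=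
  ne_zero_of_leader_eq h.leader_eq

theorem IsMinimalRelation.isNormal_tail (h : IsMinimalRelation I V v f) :
    IsNormal I V (tail f v) := by
  intro l hl
  by_cases hlv : l = v
  · subst hlv
    exact h.degreeOf_eq ▸ degreeOf_tail_lt (degreeOf_pos_of_leader_eq h.leader_eq).ne'
  · exact (degreeOf_tail_le f v l).trans_lt (h.degreeOf_lt l hl hlv)

theorem exists_isMinimalRelation [WellFoundedLT (Deriv m n)] [I.IsPrime]
    (hv : v ∈ algLeaders I V) : ∃ f, IsMinimalRelation I V v f := by
  have hvW : v ∉ V ∩ Set.Iio v := fun h => lt_irrefl v h.2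
  obtain ⟨f, hf, hfd, htop⟩ := exists_isAlgRelation_topCoeff_mem hv
  have htail := mem_supported_of_degreeOf_le (degreeOf_tail_le f v) hf.mem_insert
  obtain ⟨q, hq, hq0, r, hr, hrn, hrI⟩ :=
    mem_normalizable_insert (I := I) (fun _ => mem_normalizable_Iio) htail
  rw [Set.insert_sdiff_of_mem _ hv] at hq
  have hp := mul_mem hq htop
  have hp0 : q * topCoeff f v ≠ 0 := mul_ne_zero hq0 (topCoeff_ne_zero hf.ne_zero v)
  have hp' := supported_mono (R := k) Set.sdiff_subset hp
  have hpv := degreeOf_eq_zero_of_mem_supported hp' hvW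
  have hpN := supported_mono (R := k) (Set.sdiff_subset_sdiff_left Set.inter_subset_left) hp
  have hrd : r.degreeOf v < f.degreeOf v := hfd ▸ hrn v hv
  have hrel : IsAlgRelation I V v (q * topCoeff f v * X v ^ f.degreeOf v + r) := by
    refine isAlgRelation_mul_X_pow_add hf.mem_var hp' ?_ hr hrd ?_
    · exact notMem_of_mem_supported_sdiff ‹I.IsPrime›.ne_top hpN hp0
    · have heq : q * topCoeff f v * X v ^ f.degreeOf v + r = q * f - (q * tail f v - r) := by
        linear_combination q * topCoeff_mul_X_pow_add_tail f v
      exact heq ▸ sub_mem (I.mul_mem_left _ hf.mem) hrI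
  refine ⟨_, hrel, (degreeOf_mul_X_pow_add hp0 hpv hrd).trans hfd, fun l hl hlv => ?_, ?_⟩
  · refine (degreeOf_add_le _ _ _).trans_lt (max_lt ?_ (hrn l hl))
    rw [degreeOf_mul_X_pow_of_ne _ hlv]
    exact isNormal_of_mem_supported_sdiff hp l hl
  · rwa [topCoeff_mul_X_pow_add hp0 hpv hrd]

theorem IsMinimalRelation.of_mul [I.IsPrime] (hq : q ∈ supported k (V \ algLeaders I V))
    (h : IsMinimalRelation I V v (q * f)) : IsMinimalRelation I V v f := by
  have hq0 := left_ne_zero_of_mul h.ne_zero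
  have hf0 := right_ne_zero_of_mul h.ne_zero
  have hle : ∀ l, f.degreeOf l ≤ (q * f).degreeOf l :=
    degreeOf_le_of_dvd (dvd_mul_left f q) h.ne_zero
  have hqv := degreeOf_eq_zero_of_mem_supported hq fun hv => hv.2 h.mem_algLeaders
  have hfv : (q * f).degreeOf v = f.degreeOf v := by rw [degreeOf_mul_eq hq0 hf0, hqv, zero_add]
  have hne : f.degreeOf v ≠ 0 := hfv ▸ (degreeOf_pos_of_leader_eq h.leader_eq).ne'
  have htop : topCoeff (q * f) v = q * topCoeff f v :=
    topCoeff_mul_of_degreeOf_eq_zero hq0 hqv hne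
  refine ⟨⟨?_, mem_supported_of_degreeOf_le hle h.mem_supported,
    leader_eq_of_degreeOf_le h.leader_eq hle hne, fun hI => h.topCoeff_notMem ?_⟩,
    hfv ▸ h.degreeOf_eq, fun l hl hlv => (hle l).trans_lt (h.degreeOf_lt l hl hlv), ?_⟩
  · exact (‹I.IsPrime›.mem_or_mem h.mem).resolve_left
      (notMem_of_mem_supported_sdiff ‹I.IsPrime›.ne_top hq hq0)
  · exact htop ▸ I.mul_mem_left _ hI
  · exact mem_supported_of_degreeOf_le (degreeOf_le_of_dvd (dvd_mul_left _ _)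
      (mul_ne_zero hq0 (topCoeff_ne_zero hf0 v))) (htop ▸ h.topCoeff_mem)

theorem exists_isMinimalRelation_primitive [WellFoundedLT (Deriv m n)] [I.IsPrime]
    (hv : v ∈ algLeaders I V) : ∃ f, IsMinimalRelation I V v f ∧
      ∀ p ∈ supported k (V \ algLeaders I V), p ∣ f → leader p = ⊥ := by
  obtain ⟨f, hf, hmin⟩ := exists_minimalFor_of_wellFoundedLT (IsMinimalRelation I V v)
    totalDegree (exists_isMinimalRelation hv)
  refine ⟨f, hf, ?_⟩
  rintro p hp ⟨g, rfl⟩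
  have hle := hmin (hf.of_mul hp) (by
    rw [totalDegree_mul_of_isDomain (left_ne_zero_of_mul hf.ne_zero)
      (right_ne_zero_of_mul hf.ne_zero)]
    exact Nat.le_add_left _ _)
  rw [totalDegree_mul_of_isDomain (left_ne_zero_of_mul hf.ne_zero)
    (right_ne_zero_of_mul hf.ne_zero), add_le_iff_nonpos_left, nonpos_iff_eq_zero,
    totalDegree_eq_zero_iff_eq_C] at hle
  rw [leader_eq_bot_iff, hle, vars_C]

theorem exists_isCanonicalRelation [WellFoundedLT (Deriv m n)] [I.IsPrime]
    (hv : v ∈ algLeaders I V) : ∃ f, IsCanonicalRelation I V v f := by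
  obtain ⟨f, hf, hprim⟩ := exists_isMinimalRelation_primitive hv
  obtain ⟨a, ha, hmonic⟩ := exists_monic_C_mul hf.ne_zero
  have hfa : f = C a⁻¹ * (C a * f) := by
    rw [← mul_assoc, ← C_mul, inv_mul_cancel₀ ha, C_1, one_mul]
  refine ⟨C a * f, .of_mul (Subalgebra.algebraMap_mem _ a⁻¹) (hfa ▸ hf), hmonic, fun p hp hpf => ?_⟩
  exact hprim p hp (hfa ▸ hpf.mul_left _)

theorem IsMinimalRelation.topCoeff_mul_comm (hI : I ≠ ⊤) (hf : IsMinimalRelation I V v f)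
    (hg : IsMinimalRelation I V v g) : topCoeff g v * f = topCoeff f v * g := by
  have heq : topCoeff g v * f - topCoeff f v * g =
      topCoeff g v * tail f v + -(topCoeff f v * tail g v) := by
    have hf' := topCoeff_mul_X_pow_add_tail f v
    have hg' := topCoeff_mul_X_pow_add_tail g v
    rw [hf.degreeOf_eq] at hf'
    rw [hg.degreeOf_eq] at hg'
    linear_combination topCoeff f v * hg' - topCoeff g v * hf'
  refine sub_eq_zero.1 (IsNormal.eq_zero hI (V := V) ?_
    (sub_mem (I.mul_mem_left _ hf.mem) (I.mul_mem_left _ hg.mem))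
    (sub_mem (mul_mem (supported_mono Set.sdiff_subset hg.topCoeff_mem) hf.mem_supported)
      (mul_mem (supported_mono Set.sdiff_subset hf.topCoeff_mem) hg.mem_supported)))
  rw [heq]
  exact (hf.isNormal_tail.mul_left hg.topCoeff_mem).add
    (hg.isNormal_tail.mul_left hf.topCoeff_mem).neg

theorem IsCanonicalRelation.dvd (hI : I ≠ ⊤) (hf : IsCanonicalRelation I V v f)
    (hg : IsCanonicalRelation I V v g) : f ∣ g := by
  have hrel : IsRelPrime f (topCoeff f v) := by
    intro p hpf hpt
    have htop := topCoeff_ne_zero hf.ne_zero v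
    exact isUnit_of_leader_eq_bot (hf.primitive p (mem_supported_of_degreeOf_le
      (degreeOf_le_of_dvd hpt htop) hf.topCoeff_mem) hpf) (ne_zero_of_dvd_ne_zero htop hpt)
  refine hrel.dvd_of_dvd_mul_left ⟨topCoeff g v, ?_⟩
  rw [← hf.topCoeff_mul_comm hI hg.toIsMinimalRelation, mul_comm]

theorem IsCanonicalRelation.unique (hI : I ≠ ⊤) (hf : IsCanonicalRelation I V v f)
    (hg : IsCanonicalRelation I V v g) : f = g := by
  obtain ⟨u, rfl⟩ := associated_of_dvd_dvd (hf.dvd hI hg) (hg.dvd hI hf)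
  obtain ⟨a, -, ha⟩ := MvPolynomial.isUnit_iff_eq_C_of_isReduced.1 u.isUnit
  have hmonic := hg.monic
  rw [mul_comm, ha] at hmonic ⊢
  exact (hf.monic.eq_of_C_mul hmonic).symm

end CanonicalRelation

section CanonicalSet

variable {k : Type*} [Field k] {m n : ℕ} [LinearOrder (Deriv m n)]
variable {I : Ideal (DiffPoly k m n)} {V : Set (Deriv m n)} {u v : Deriv m n}
variable {f g : DiffPoly k m n} {X A B : Set (DiffPoly k m n)}

/-- The set of the canonical relations of `I ∩ k[V]`, which contains one polynomial for each leader
of `V` modulo `I`. -/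
def canonicalSet (I : Ideal (DiffPoly k m n)) (V : Set (Deriv m n)) : Set (DiffPoly k m n) :=
  {f | ∃ v, IsCanonicalRelation I V v f}

theorem isCanonicalRelation_of_mem_canonicalSet (hf : f ∈ canonicalSet I V)
    (hv : leader f = ↑v) : IsCanonicalRelation I V v f := by
  obtain ⟨u, hu⟩ := hf
  rwa [leader_unique hv hu.leader_eq]

theorem canonicalSet_subset_algSection : canonicalSet I V ⊆ algSection I V :=
  fun _ ⟨_, h⟩ => ⟨h.mem, h.mem_supported⟩

theorem injOn_leader_canonicalSet (hI : I ≠ ⊤) : (canonicalSet I V).InjOn leader :=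
  fun _ ⟨_, hf⟩ _ hg h =>
    hf.unique hI (isCanonicalRelation_of_mem_canonicalSet hg (h ▸ hf.leader_eq))

theorem leaders_canonicalSet [WellFoundedLT (Deriv m n)] [I.IsPrime] :
    leaders (canonicalSet I V) = algLeaders I V := by
  ext v
  constructor
  · rintro ⟨f, hf, hv⟩
    exact (isCanonicalRelation_of_mem_canonicalSet hf hv).mem_algLeaders
  · intro hv
    obtain ⟨f, hf⟩ := exists_isCanonicalRelation hv
    exact ⟨f, ⟨v, hf⟩, hf.leader_eq⟩

theorem IsMinimalRelation.algReduced (hf : IsMinimalRelation I V u f)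
    (hg : IsMinimalRelation I V v g) (huv : u ≠ v) : AlgReduced f g := by
  intro w hw
  obtain rfl := leader_unique hg.leader_eq hw
  exact hg.degreeOf_eq ▸ hf.degreeOf_lt _ hg.mem_algLeaders huv.symm

theorem algAutoreduced_canonicalSet (hI : I ≠ ⊤) : AlgAutoreduced (canonicalSet I V) := by
  refine ⟨fun f ⟨v, hf⟩ => hf.leader_eq ▸ WithBot.coe_ne_bot, ?_⟩
  rintro f ⟨u, hf⟩ g ⟨v, hg⟩ hfg
  refine hf.toIsMinimalRelation.algReduced hg.toIsMinimalRelation ?_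
  rintro rfl
  exact hfg (hf.unique hI hg)

theorem eq_zero_of_algReduced_canonicalSet [WellFoundedLT (Deriv m n)] [I.IsPrime]
    (hf : f ∈ algSection I V) (h : ∀ g ∈ canonicalSet I V, AlgReduced f g) : f = 0 := by
  refine IsNormal.eq_zero ‹I.IsPrime›.ne_top (fun l hl => ?_) hf.1 hf.2
  obtain ⟨g, hg⟩ := exists_isCanonicalRelation hl
  exact hg.degreeOf_eq ▸ h g ⟨l, hg⟩ l hg.leader_eq

theorem isAlgCharSet_canonicalSet [WellFoundedLT (Deriv m n)] [I.IsPrime] :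
    IsAlgCharSet (algSection I V) (canonicalSet I V) := by
  refine ⟨canonicalSet_subset_algSection, algAutoreduced_canonicalSet ‹I.IsPrime›.ne_top,
    fun B hBX hB hlt => ?_⟩
  obtain ⟨f, hf, hred⟩ := hlt.exists_algReduced hB
  refine hB.1 f hf (leader_eq_bot_iff.2 ?_)
  rw [eq_zero_of_algReduced_canonicalSet (hBX hf) hred, vars_0]

theorem isCanonicalAlgCharSet_canonicalSet [WellFoundedLT (Deriv m n)] [I.IsPrime] :
    IsCanonicalAlgCharSet V (algSection I V) (canonicalSet I V) := by
  refine ⟨isAlgCharSet_canonicalSet, fun f hf => ?_⟩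
  rw [leaders_canonicalSet]
  have hrel {v} := isCanonicalRelation_of_mem_canonicalSet (v := v) hf
  obtain ⟨v, h⟩ := hf
  exact ⟨fun u hu => (hrel hu).topCoeff_mem, h.monic, h.primitive⟩

theorem IsAlgCharSet.image_rk_eq [WellFoundedLT (Deriv m n)] (hA : IsAlgCharSet X A)
    (hB : IsAlgCharSet X B) : rk '' A = rk '' B :=
  image_rk_eq_of_not_lowerRank (hB.2.2 A hA.1 hA.2.1) (hA.2.2 B hB.1 hB.2.1)

theorem IsCanonicalAlgCharSet.subset_canonicalSet [WellFoundedLT (Deriv m n)] [I.IsPrime]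
    (hA : IsCanonicalAlgCharSet V (algSection I V) A) : A ⊆ canonicalSet I V := by
  intro f hf
  have hrk := hA.1.image_rk_eq (isAlgCharSet_canonicalSet (I := I) (V := V))
  obtain ⟨htop, hmonic, hprim⟩ := hA.2 f hf
  rw [leaders_eq_of_image_rk_eq hrk, leaders_canonicalSet] at htop hprim
  obtain ⟨g, ⟨v, hg⟩, hgf⟩ : rk f ∈ rk '' canonicalSet I V := hrk ▸ Set.mem_image_of_mem rk hf
  have hv : leader f = ↑v := (leader_eq_of_rk_eq hgf).symm.trans hg.leader_eq
  have htopI : topCoeff f v ∉ I := notMem_of_mem_supported_sdiff ‹I.IsPrime›.ne_top (htop v hv)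
    (topCoeff_ne_zero (ne_zero_of_leader_eq hv) v)
  have hdeg : f.degreeOf v = leadDegree I V v :=
    (degreeOf_eq_of_rk_eq hgf hg.leader_eq).symm.trans hg.degreeOf_eq
  refine ⟨v, ⟨⟨(hA.1.1 hf).1, (hA.1.1 hf).2, hv, htopI⟩, hdeg, fun l hl hlv => ?_, htop v hv⟩,
    hmonic, hprim⟩
  obtain ⟨e, he⟩ := exists_isCanonicalRelation hl
  obtain ⟨e', he'A, he'⟩ : rk e ∈ rk '' A := hrk ▸ Set.mem_image_of_mem rk ⟨l, he⟩
  have hne : f ≠ e' := by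
    rintro rfl
    exact hlv (leader_unique he.leader_eq ((leader_eq_of_rk_eq he').symm.trans hv))
  exact he.degreeOf_eq ▸ (hA.1.2.1.2 f hf e' he'A hne).congr_rk he' l he.leader_eq

theorem isCanonicalAlgCharSet_iff [WellFoundedLT (Deriv m n)] [I.IsPrime] :
    IsCanonicalAlgCharSet V (algSection I V) A ↔ A = canonicalSet I V := by
  refine ⟨fun hA => ?_, fun hA => hA ▸ isCanonicalAlgCharSet_canonicalSet⟩
  exact ((injOn_rk_of_injOn_leader
    (injOn_leader_canonicalSet ‹I.IsPrime›.ne_top)).image_eq_image_iff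
      hA.subset_canonicalSet subset_rfl).1 (hA.1.image_rk_eq isAlgCharSet_canonicalSet)

end CanonicalSet

section Ranking

variable {m n : ℕ} {θ : Fin m →₀ ℕ} {u v : Deriv m n}

theorem act_zero (u : Deriv m n) : act 0 u = u :=
  Deriv.ext (zero_add _) rfl

theorem act_add (θ₁ θ₂ : Fin m →₀ ℕ) (u : Deriv m n) :
    act (θ₁ + θ₂) u = act θ₁ (act θ₂ u) :=
  Deriv.ext (add_assoc _ _ _) rfl

theorem act_injective (θ : Fin m →₀ ℕ) : Function.Injective (act θ : Deriv m n → Deriv m n) :=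
  fun _ _ h => Deriv.ext (add_left_cancel (congrArg Deriv.op h)) (congrArg Deriv.var h :)

theorem act_ne_self (hθ : θ ≠ 0) (u : Deriv m n) : act θ u ≠ u :=
  fun h => hθ (add_eq_right.1 (congrArg Deriv.op h))

theorem eq_or_isProperDerivative_act (θ : Fin m →₀ ℕ) (u : Deriv m n) :
    act θ u = u ∨ IsProperDerivative (act θ u) u := by
  rcases eq_or_ne θ 0 with rfl | hθ
  · exact .inl (act_zero u)
  · exact .inr ⟨θ, hθ, rfl⟩

theorem subset_derivsOf (S : Set (Deriv m n)) : S ⊆ derivsOf S :=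
  fun u hu => ⟨u, hu, 0, (act_zero u).symm⟩

variable [LinearOrder (Deriv m n)]

theorem IsRanking.lt_of_isProperDerivative (hr : IsRanking m n) (h : IsProperDerivative v u) :
    u < v := by
  obtain ⟨θ, hθ, rfl⟩ := h
  exact (hr.le_act θ u).lt_of_ne (act_ne_self hθ u).symm

theorem IsRanking.lt_act_single (hr : IsRanking m n) (i : Fin m) (u : Deriv m n) :
    u < act (Finsupp.single i 1) u :=
  hr.lt_of_isProperDerivative ⟨_, by simp, rfl⟩

theorem IsRanking.act_lt_act (hr : IsRanking m n) (θ : Fin m →₀ ℕ) (huv : u < v) :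
    act θ u < act θ v :=
  (hr.act_le_act θ v u huv.le).lt_of_ne ((act_injective θ).ne huv.ne)

theorem IsRanking.wellFoundedLT (hr : IsRanking m n) : WellFoundedLT (Deriv m n) := by
  refine ⟨wellFounded_iff_isEmpty_descending_chain.2 ⟨fun ⟨f, hf⟩ => ?_⟩⟩
  -- Dickson's lemma
  have hwqo : WellQuasiOrdered fun a b : (Fin m →₀ ℕ) × Fin n => a.1 ≤ b.1 ∧ a.2 = b.2 :=
    wellQuasiOrdered_le.prod (Finite.wellQuasiOrdered (· = ·))
  obtain ⟨i, j, hij, hop, hvar⟩ := hwqo fun i => ((f i).op, (f i).var)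
  have hact : f j = act ((f j).op - (f i).op) (f i) :=
    Deriv.ext (tsub_add_cancel_of_le hop).symm hvar.symm
  have hle : f i ≤ f j := hact ▸ hr.le_act _ _
  exact hle.not_gt (strictAnti_nat_of_succ_lt hf hij)

end Ranking

section Prolongation

variable {k : Type*} [Field k] {m n : ℕ} {I : Ideal (DiffPoly k m n)}
variable {d : Fin m → Derivation ℤ k k} {u : Deriv m n} {f : DiffPoly k m n}

theorem degreeOf_coeffMap_le (D : Derivation ℤ k k) (f : DiffPoly k m n) (u : Deriv m n) :
    (coeffMap D f).degreeOf u ≤ f.degreeOf u := by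
  refine degreeOf_le_iff.2 fun s hs => monomial_le_degreeOf u ?_
  rw [mem_support_iff, coeff_coeffMap] at hs
  exact mem_support_iff.2 fun h => hs (by rw [h, map_zero])

variable [LinearOrder (Deriv m n)]

theorem IsRanking.exists_delta_eq (hr : IsRanking m n) (d : Fin m → Derivation ℤ k k) (i : Fin m)
    (hf : f ∈ supported k (Set.Iic u)) :
    ∃ r ∈ supported k (Set.Iio (act (Finsupp.single i 1) u)),
      delta d i f = pderiv u f * X (act (Finsupp.single i 1) u) + r := by
  classical
  have hsupp {g : DiffPoly k m n} (hg : ∀ l, g.degreeOf l ≤ f.degreeOf l) :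
      g ∈ supported k (Set.Iio (act (Finsupp.single i 1) u)) :=
    supported_mono (fun l hl => lt_of_le_of_lt hl (hr.lt_act_single i u))
      (mem_supported_of_degreeOf_le hg hf)
  refine ⟨coeffMap (d i) f + ∑ l ∈ f.vars.erase u, pderiv l f * X (act (Finsupp.single i 1) l),
    add_mem (hsupp (degreeOf_coeffMap_le _ f)) (sum_mem fun l hl => mul_mem
      (hsupp (degreeOf_pderiv_le f l)) (X_mem_supported.2 ?_)), ?_⟩
  · obtain ⟨hlu, hlf⟩ := Finset.mem_erase.1 hl
    exact hr.act_lt_act _ (lt_of_le_of_ne (mem_supported.1 hf hlf) hlu)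
  · have hsum : ∑ l ∈ f.vars, pderiv l f * X (act (Finsupp.single i 1) l) =
        pderiv u f * X (act (Finsupp.single i 1) u) +
          ∑ l ∈ f.vars.erase u, pderiv l f * X (act (Finsupp.single i 1) l) := by
      by_cases hu : u ∈ f.vars
      · exact (Finset.add_sum_erase _ _ hu).symm
      · rw [Finset.erase_eq_of_notMem hu, pderiv_eq_zero_of_notMem_vars hu, zero_mul, zero_add]
    rw [delta, mkDerivation_eq_sum_pderiv, hsum, add_left_comm]

/-- `I` contains a polynomial in the derivatives up to `u` whose separant with respect to `u` does
not lie in `I`: then `u` is separably algebraic modulo `I` over the smaller derivatives. -/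
def HasSeparableRelation (I : Ideal (DiffPoly k m n)) (u : Deriv m n) : Prop :=
  ∃ f ∈ I, f ∈ supported k (Set.Iic u) ∧ pderiv u f ∉ I

/-- `I` contains a polynomial that is linear in `u`, with coefficients in the smaller derivatives
and leading coefficient outside `I`: then `u` is rational modulo `I` over the smaller
derivatives. -/
def HasLinearRelation (I : Ideal (DiffPoly k m n)) (u : Deriv m n) : Prop :=
  ∃ s ∈ supported k (Set.Iio u), ∃ r ∈ supported k (Set.Iio u), s ∉ I ∧ s * X u + r ∈ I

theorem HasLinearRelation.hasSeparableRelation (h : HasLinearRelation I u) :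
    HasSeparableRelation I u := by
  obtain ⟨s, hs, r, hr, hsI, hI⟩ := h
  have hpderiv {g : DiffPoly k m n} (hg : g ∈ supported k (Set.Iio u)) : pderiv u g = 0 :=
    pderiv_eq_zero_of_notMem_vars fun hu => lt_irrefl u (mem_supported.1 hg hu)
  have hle := supported_mono (R := k) (Set.Iio_subset_Iic_self (a := u))
  refine ⟨_, hI, add_mem (mul_mem (hle hs) (X_mem_supported.2 Set.self_mem_Iic)) (hle hr), ?_⟩
  rwa [map_add, pderiv_mul, hpderiv hs, hpderiv hr, pderiv_X_self, zero_mul, zero_add, mul_one,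
    add_zero]

theorem HasLinearRelation.exists_isAlgRelation (h : HasLinearRelation I u) :
    ∃ f, IsAlgRelation I Set.univ u f ∧ f.degreeOf u = 1 := by
  obtain ⟨s, hs, r, hr, hsI, hI⟩ := h
  have hs0 : s ≠ 0 := fun h => hsI (h ▸ I.zero_mem)
  have hdeg {g : DiffPoly k m n} (hg : g ∈ supported k (Set.Iio u)) : g.degreeOf u = 0 :=
    degreeOf_eq_zero_of_mem_supported hg Set.self_notMem_Iio
  have hrd : r.degreeOf u < 1 := hdeg hr ▸ one_pos
  rw [← pow_one (X u)] at hI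
  refine ⟨_, isAlgRelation_mul_X_pow_add (Set.mem_univ u) (by rwa [Set.univ_inter]) hsI ?_ hrd hI,
    degreeOf_mul_X_pow_add hs0 (hdeg hs) hrd⟩
  rw [Set.univ_inter]
  exact supported_mono (Set.subset_insert _ _) hr

theorem HasSeparableRelation.hasLinearRelation_act_single (hr : IsRanking m n)
    (hI : IsDifferentialIdeal d I) (i : Fin m) (h : HasSeparableRelation I u) :
    HasLinearRelation I (act (Finsupp.single i 1) u) := by
  obtain ⟨f, hf, hfu, hsep⟩ := h
  obtain ⟨r, hrs, hdelta⟩ := hr.exists_delta_eq d i hfu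
  refine ⟨pderiv u f, supported_mono ?_ (mem_supported_of_degreeOf_le (degreeOf_pderiv_le f u) hfu),
    r, hrs, hsep, hdelta ▸ hI i f hf⟩
  exact fun l hl => lt_of_le_of_lt hl (hr.lt_act_single i u)

theorem HasSeparableRelation.act (hr : IsRanking m n) (hI : IsDifferentialIdeal d I)
    (θ : Fin m →₀ ℕ) (h : HasSeparableRelation I u) : HasSeparableRelation I (act θ u) := by
  induction θ using Finsupp.induction_linear generalizing u with
  | zero => rwa [act_zero]
  | add θ₁ θ₂ h₁ h₂ =>
    rw [act_add]
    exact h₁ (h₂ h)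
  | single i a =>
    induction a with
    | zero => rwa [Finsupp.single_zero, act_zero]
    | succ a ih =>
      rw [add_comm, Finsupp.single_add, act_add]
      exact (ih.hasLinearRelation_act_single hr hI i).hasSeparableRelation

theorem HasSeparableRelation.hasLinearRelation_of_isProperDerivative {v : Deriv m n}
    (hr : IsRanking m n) (hI : IsDifferentialIdeal d I) (h : HasSeparableRelation I u)
    (hv : IsProperDerivative v u) : HasLinearRelation I v := by
  obtain ⟨θ, hθ, rfl⟩ := hv
  obtain ⟨i, hi⟩ := Finsupp.ne_iff.1 hθ
  rw [← Finsupp.sub_add_single_one_cancel hi, add_comm, act_add]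
  exact (h.act hr hI _).hasLinearRelation_act_single hr hI i

end Prolongation

section CharSet

variable {k : Type*} [Field k] {m n : ℕ} [LinearOrder (Deriv m n)]
variable {I : Ideal (DiffPoly k m n)} {V : Set (Deriv m n)} {u v l : Deriv m n}
variable {f g : DiffPoly k m n} {A B C : Set (DiffPoly k m n)}

theorem IsRanking.partiallyReduced_of_leader_le (hr : IsRanking m n) (h : leader f ≤ leader g) :
    PartiallyReduced f g := by
  intro u hu v hv hvu
  have hvu' : (v : WithBot (Deriv m n)) ≤ u := (Finset.le_max hv).trans (hu ▸ h)
  exact (hr.lt_of_isProperDerivative hvu).not_ge (WithBot.coe_le_coe.1 hvu')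

theorem Autoreduced.mono (hAB : A ⊆ B) (hB : Autoreduced B) : Autoreduced A :=
  ⟨fun f hf => hB.1 f (hAB hf), fun f hf g hg => hB.2 f (hAB hf) g (hAB hg)⟩

theorem Autoreduced.insert (hr : IsRanking m n) (hA : Autoreduced A) (hf : leader f ≠ ⊥)
    (hlt : ∀ g ∈ A, rk g < rk f) (hred : ∀ g ∈ A, PartiallyReduced f g ∧ AlgReduced f g) :
    Autoreduced (insert f A) := by
  refine ⟨Set.forall_mem_insert.2 ⟨hf, hA.1⟩, ?_⟩
  rintro g (rfl | hg) h (rfl | hh) hne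
  · exact absurd rfl hne
  · exact hred h hh
  · exact ⟨hr.partiallyReduced_of_leader_le (leader_le_of_rk_lt (hlt g hg)), .of_rk_lt (hlt g hg)⟩
  · exact hA.2 g hg h hh hne

theorem Autoreduced.partiallyReduced (hr : IsRanking m n) (hA : Autoreduced A) (hf : f ∈ A)
    (hg : g ∈ A) : PartiallyReduced f g := by
  by_cases hfg : f = g
  · exact hr.partiallyReduced_of_leader_le (hfg ▸ le_rfl)
  · exact (hA.2 f hf g hg hfg).1

theorem Autoreduced.mem_leaders_of_mem_vars (hr : IsRanking m n) (hA : Autoreduced A)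
    (hf : f ∈ A) (hv : v ∈ f.vars) (hvA : v ∈ derivsOf (leaders A)) : v ∈ leaders A := by
  obtain ⟨u, ⟨g, hg, hu⟩, θ, rfl⟩ := hvA
  rcases eq_or_isProperDerivative_act θ u with heq | hprop
  · exact heq.symm ▸ ⟨g, hg, hu⟩
  · exact absurd hprop (hA.partiallyReduced hr hf hg u hu _ hv)

theorem IsCharSet.eq_zero_of_reduced (hr : IsRanking m n) (hI : I ≠ ⊤)
    (hC : IsCharSet (I : Set (DiffPoly k m n)) C) (hf : f ∈ I)
    (hred : ∀ g ∈ C, PartiallyReduced f g ∧ AlgReduced f g) : f = 0 := by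
  by_contra hf0
  have hrk : rk f ∉ rk '' C := by
    rintro ⟨g, hg, hgf⟩
    exact (hred g hg).2.rk_ne (hC.2.1.1 g hg) hgf.symm
  have hsub : {g ∈ C | rk g < rk f} ⊆ C := Set.sep_subset _ _
  exact hC.2.2 _ (Set.insert_subset hf (hsub.trans hC.1))
    ((hC.2.1.mono hsub).insert hr (leader_ne_bot_of_mem hI hf hf0) (fun g hg => hg.2)
      fun g hg => hred g hg.1) (lowerRank_insert_rk_lt hrk)

theorem IsCharSet.eq_zero_of_degreeOf_le (hr : IsRanking m n) (hI : I ≠ ⊤)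
    (hC : IsCharSet (I : Set (DiffPoly k m n)) C) (hg : g ∈ C) (hu : leader g = ↑u) (hf : f ∈ I)
    (hle : ∀ l, f.degreeOf l ≤ g.degreeOf l) (hlt : f.degreeOf u < g.degreeOf u) : f = 0 := by
  refine hC.eq_zero_of_reduced hr hI hf fun h hh => ⟨fun w hw v hv => ?_, fun w hw => ?_⟩
  · refine hC.2.1.partiallyReduced hr hg hh w hw v (mem_vars_iff_degreeOf_ne_zero.2 ?_)
    exact ((mem_vars_iff_degreeOf_ne_zero.1 hv).bot_lt.trans_le (hle v)).ne'
  · by_cases hgh : g = h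
    · subst hgh
      rwa [← leader_unique hu hw]
    · exact (hle w).trans_lt ((hC.2.1.2 g hg h hh hgh).2 w hw)

theorem IsCharSet.isAlgRelation (hr : IsRanking m n) (hI : I ≠ ⊤)
    (hC : IsCharSet (I : Set (DiffPoly k m n)) C) (hg : g ∈ C) (hgV : g ∈ supported k V)
    (hu : leader g = ↑u) : IsAlgRelation I V u g := by
  refine ⟨hC.1 hg, hgV, hu, fun htop => topCoeff_ne_zero (ne_zero_of_leader_eq hu) u ?_⟩
  exact hC.eq_zero_of_degreeOf_le hr hI hg hu htop (degreeOf_topCoeff_le g u)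
    (degreeOf_topCoeff_self g u ▸ degreeOf_pos_of_leader_eq hu)

theorem IsCharSet.hasSeparableRelation [CharZero k] (hr : IsRanking m n) (hI : I ≠ ⊤)
    (hC : IsCharSet (I : Set (DiffPoly k m n)) C) (hg : g ∈ C) (hu : leader g = ↑u) :
    HasSeparableRelation I u := by
  obtain ⟨hmem, hmax⟩ := leader_eq_coe_iff.1 hu
  refine ⟨g, hC.1 hg, mem_supported.2 hmax, fun hsep => pderiv_ne_zero hmem ?_⟩
  exact hC.eq_zero_of_degreeOf_le hr hI hg hu hsep (degreeOf_pderiv_le g u)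
    (degreeOf_pderiv_lt (degreeOf_pos_of_leader_eq hu).ne')

theorem IsMinimalRelation.degreeOf_eq_zero_of_hasLinearRelation
    (hf : IsMinimalRelation I Set.univ v f) (hl : HasLinearRelation I l) (hlv : l ≠ v) :
    f.degreeOf l = 0 := by
  obtain ⟨g, hg, hdeg⟩ := hl.exists_isAlgRelation
  have hle := hg.leadDegree_le
  have hlt := hf.degreeOf_lt l hg.mem_algLeaders hlv
  omega

section Differential

variable [CharZero k] {d : Fin m → Derivation ℤ k k}

/- Otherwise `f` would be reduced: the proper derivatives of the leaders of `C` have degree one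
modulo `I`, so that none of them occurs in the minimal relation `f`. -/
theorem IsMinimalRelation.exists_mem_charSet (hr : IsRanking m n) (hI : I ≠ ⊤)
    (hdI : IsDifferentialIdeal d I) (hC : IsCharSet (I : Set (DiffPoly k m n)) C)
    (hf : IsMinimalRelation I Set.univ v f) :
    ∃ g ∈ C, ∃ u : Deriv m n, leader g = ↑u ∧
      (IsProperDerivative v u ∨ v = u ∧ g.degreeOf v ≤ leadDegree I Set.univ v) := by
  by_contra! hcon
  refine hf.ne_zero (hC.eq_zero_of_reduced hr hI hf.mem fun g hg =>
    ⟨fun u hu l hl hlu => ?_, fun u hu => ?_⟩)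
  · have hlin := (hC.hasSeparableRelation hr hI hg hu).hasLinearRelation_of_isProperDerivative
      hr hdI hlu
    refine mem_vars_iff_degreeOf_ne_zero.1 hl (hf.degreeOf_eq_zero_of_hasLinearRelation hlin ?_)
    rintro rfl
    exact (hcon g hg u hu).1 hlu
  · by_cases huv : v = u
    · subst huv
      exact hf.degreeOf_eq ▸ (hcon g hg v hu).2 rfl
    · have hrel := hC.isAlgRelation hr hI hg (mem_supported.2 (Set.subset_univ _)) hu
      exact (hf.degreeOf_lt u hrel.mem_algLeaders (Ne.symm huv)).trans_le hrel.leadDegree_le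

theorem IsCharSet.algLeaders_subset [I.IsPrime] (hr : IsRanking m n)
    (hdI : IsDifferentialIdeal d I) (hC : IsCharSet (I : Set (DiffPoly k m n)) C)
    (V : Set (Deriv m n)) : algLeaders I V ⊆ derivsOf (leaders C) := by
  have := hr.wellFoundedLT
  intro v hv
  obtain ⟨f, hf⟩ := exists_isMinimalRelation (algLeaders_mono (Set.subset_univ V) hv)
  obtain ⟨g, hg, u, hu, ⟨θ, -, rfl⟩ | ⟨rfl, -⟩⟩ :=
    hf.exists_mem_charSet hr ‹I.IsPrime›.ne_top hdI hC
  · exact ⟨u, ⟨g, hg, hu⟩, θ, rfl⟩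
  · exact subset_derivsOf _ ⟨g, hg, hu⟩

theorem IsCharSet.degreeOf_eq_leadDegree [I.IsPrime] (hr : IsRanking m n)
    (hdI : IsDifferentialIdeal d I) (hC : IsCharSet (I : Set (DiffPoly k m n)) C) (hg : g ∈ C)
    (hgV : g ∈ supported k V) (hu : leader g = ↑u) : g.degreeOf u = leadDegree I V u := by
  have := hr.wellFoundedLT
  have hI : I ≠ ⊤ := ‹I.IsPrime›.ne_top
  have hrel := hC.isAlgRelation hr hI hg hgV hu
  have hanti := leadDegree_anti (Set.subset_univ V) hrel.mem_algLeaders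
  refine le_antisymm (le_trans ?_ hanti) hrel.leadDegree_le
  obtain ⟨f, hf⟩ := exists_isMinimalRelation (hrel.mono (Set.subset_univ V)).mem_algLeaders
  obtain ⟨h, hh, w, hw, hprop | ⟨rfl, hle⟩⟩ := hf.exists_mem_charSet hr hI hdI hC
  · exact absurd hprop (hC.2.1.partiallyReduced hr hg hh w hw u (leader_eq_coe_iff.1 hu).1)
  · rwa [hC.2.1.algAutoreduced.injOn_leader hg hh (hu.trans hw.symm)]

theorem IsCharSet.degreeOf_lt_leadDegree [I.IsPrime] (hr : IsRanking m n)
    (hdI : IsDifferentialIdeal d I) (hC : IsCharSet (I : Set (DiffPoly k m n)) C)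
    (hCV : C ⊆ algSection I V) (hf : f ∈ C) (hl : l ∈ algLeaders I V) (hlf : leader f ≠ ↑l) :
    f.degreeOf l < leadDegree I V l := by
  rcases eq_or_ne (f.degreeOf l) 0 with h0 | h0
  · exact h0 ▸ leadDegree_pos hl
  · obtain ⟨g, hg, hgl⟩ := hC.2.1.mem_leaders_of_mem_vars hr hf
      (mem_vars_iff_degreeOf_ne_zero.2 h0) (hC.algLeaders_subset hr hdI V hl)
    rw [← hC.degreeOf_eq_leadDegree hr hdI hg (hCV hg).2 hgl]
    refine (hC.2.1.2 f hf g hg ?_).2 l hgl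
    rintro rfl
    exact hlf hgl

theorem IsCanonicalCharSet.subset_canonicalSet [I.IsPrime] (hr : IsRanking m n)
    (hdI : IsDifferentialIdeal d I) (hC : IsCanonicalCharSet (I : Set (DiffPoly k m n)) C)
    (hCV : C ⊆ algSection I V) : C ⊆ canonicalSet I V := by
  intro f hf
  obtain ⟨htop, hmonic, hprim⟩ := hC.2 f hf
  obtain ⟨v, hv⟩ := exists_leader_eq_coe (hC.1.2.1.1 f hf)
  have hrel {g : DiffPoly k m n} {u : Deriv m n} (hg : g ∈ C) (hu : leader g = ↑u) :
      IsAlgRelation I V u g := hC.1.isAlgRelation hr ‹I.IsPrime›.ne_top hg (hCV hg).2 hu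
  refine ⟨v, ⟨⟨hrel hf hv, hC.1.degreeOf_eq_leadDegree hr hdI hf (hCV hf).2 hv,
    fun l hl hlv => hC.1.degreeOf_lt_leadDegree hr hdI hCV hf hl fun h =>
      hlv (leader_unique h hv), ?_⟩, hmonic, fun p hp hpf => hprim p ?_ hpf⟩⟩
  · refine mem_supported.2 fun l hl => ⟨?_, fun hlL => ?_⟩
    · exact mem_supported.1 (mem_supported_of_degreeOf_le (degreeOf_topCoeff_le f v)
        (hCV hf).2) hl
    · exact mem_supported.1 (htop v hv) hl (hC.1.algLeaders_subset hr hdI V hlL)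
  · refine mem_supported.2 fun l hl hlC => (mem_supported.1 hp hl).2 ?_
    have hlf : l ∈ f.vars := mem_vars_iff_degreeOf_ne_zero.2
      ((mem_vars_iff_degreeOf_ne_zero.1 hl).bot_lt.trans_le
        (degreeOf_le_of_dvd hpf (ne_zero_of_leader_eq hv) l)).ne'
    obtain ⟨g, hg, hgl⟩ := hC.1.2.1.mem_leaders_of_mem_vars hr hf hlf hlC
    exact (hrel hg hgl).mem_algLeaders

end Differential

end CharSet

section WeakDTriangular

variable {k : Type*} [Field k] {m n : ℕ} [LinearOrder (Deriv m n)]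
variable {C D T : Set (DiffPoly k m n)}

theorem Autoreduced.weakDTriangular (hC : Autoreduced C) : WeakDTriangular C := by
  refine ⟨hC.1, fun f hf g hg hfg u v hu hv θ huv => ?_⟩
  rcases eq_or_isProperDerivative_act θ v with heq | hprop
  · exact hfg (hC.algAutoreduced.injOn_leader hf hg (by rw [hu, hv, huv, heq]))
  · exact (hC.2 f hf g hg hfg).1 v hv u (leader_eq_coe_iff.1 hu).1 (huv ▸ hprop)

theorem WeakDTriangular.not_lowerRank (hr : IsRanking m n) (hD : D.InjOn leader) (hCD : C ⊆ D)
    (hlead : leaders D ⊆ derivsOf (leaders C)) (hTD : T ⊆ D) (hT : WeakDTriangular T) :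
    ¬ LowerRank T C := by
  rintro ⟨f, hf, hfC, hlow⟩
  obtain ⟨v, hv⟩ := exists_leader_eq_coe (hT.1 f hf)
  obtain ⟨u, ⟨g, hg, hu⟩, θ, rfl⟩ := hlead ⟨f, hTD hf, hv⟩
  rcases eq_or_isProperDerivative_act θ u with heq | hprop
  · exact hfC ⟨g, hg, congrArg rk (hD (hCD hg) (hTD hf) (by rw [hu, hv, heq]))⟩
  · have hlt := hr.lt_of_isProperDerivative hprop
    obtain ⟨h, hh, hhg⟩ := (hlow (rk g) ((rk_lt_rk_iff hu hv).2 (.inl hlt))).2 ⟨g, hg, rfl⟩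
    have hhu : leader h = ↑u := (leader_eq_of_rk_eq hhg).trans hu
    refine hT.2 f hf h hh ?_ _ u hv hhu θ rfl
    rintro rfl
    exact hlt.ne (leader_unique hhu hv)

theorem isLeastWeakDTriangularSubset_iff (hr : IsRanking m n) (hD : D.InjOn leader) (hCD : C ⊆ D)
    (hC : WeakDTriangular C) (hlead : leaders D ⊆ derivsOf (leaders C)) :
    IsLeastWeakDTriangularSubset D T ↔ T = C := by
  have := hr.wellFoundedLT
  constructor
  · rintro ⟨hTD, hT, hleast⟩
    exact ((injOn_rk_of_injOn_leader hD).image_eq_image_iff hTD hCD).1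
      (image_rk_eq_of_not_lowerRank (hT.not_lowerRank hr hD hCD hlead hTD) (hleast C hCD hC))
  · rintro rfl
    exact ⟨hCD, hC, fun T hTD hT => hT.not_lowerRank hr hD hCD hlead hTD⟩

end WeakDTriangular

end DiffAlg

end

theorem lemmal_general {k : Type*} [Field k] [CharZero k] {m n : ℕ}
    (d : Fin m → Derivation ℤ k k)
    [LinearOrder (DiffAlg.Deriv m n)] (hrank : DiffAlg.IsRanking m n)
    (I : Ideal (DiffAlg.DiffPoly k m n)) (hprime : I.IsPrime)
    (hI : DiffAlg.IsDifferentialIdeal d I)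
    (C : Set (DiffAlg.DiffPoly k m n))
    (hC : DiffAlg.IsCanonicalCharSet (I : Set (DiffAlg.DiffPoly k m n)) C)
    (V : Set (DiffAlg.Deriv m n)) (hCV : C ⊆ DiffAlg.algSection I V) :
    ∃ D : Set (DiffAlg.DiffPoly k m n),
      (∀ D' : Set (DiffAlg.DiffPoly k m n),
        DiffAlg.IsCanonicalAlgCharSet V (DiffAlg.algSection I V) D' ↔ D' = D) ∧
      C ⊆ D ∧
      ∀ T : Set (DiffAlg.DiffPoly k m n),
        DiffAlg.IsLeastWeakDTriangularSubset D T ↔ T = C := by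
  have := hrank.wellFoundedLT
  have hCD := hC.subset_canonicalSet hrank hI hCV
  have hlead : DiffAlg.leaders (DiffAlg.canonicalSet I V) ⊆
      DiffAlg.derivsOf (DiffAlg.leaders C) := by
    rw [DiffAlg.leaders_canonicalSet]
    exact hC.1.algLeaders_subset hrank hI V
  exact ⟨DiffAlg.canonicalSet I V, fun _ => DiffAlg.isCanonicalAlgCharSet_iff, hCD, fun _ =>
    DiffAlg.isLeastWeakDTriangularSubset_iff hrank
      (DiffAlg.injOn_leader_canonicalSet hprime.ne_top) hCD hC.1.2.1.weakDTriangular hlead⟩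

theorem lemmal {k : Type*} [Field k] [CharZero k] {m n : ℕ}
    (d : Fin m → Derivation ℤ k k) (hd : ∀ i j a, d i (d j a) = d j (d i a))
    [LinearOrder (DiffAlg.Deriv m n)] (hrank : DiffAlg.IsRanking m n)
    (I : Ideal (DiffAlg.DiffPoly k m n)) (hprime : I.IsPrime)
    (hI : DiffAlg.IsDifferentialIdeal d I)
    (C : Set (DiffAlg.DiffPoly k m n))
    (hC : DiffAlg.IsCanonicalCharSet (I : Set (DiffAlg.DiffPoly k m n)) C)
    (V : Set (DiffAlg.Deriv m n)) (hCV : C ⊆ DiffAlg.algSection I V) :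
    ∃ D : Set (DiffAlg.DiffPoly k m n),
      (∀ D' : Set (DiffAlg.DiffPoly k m n),
        DiffAlg.IsCanonicalAlgCharSet V (DiffAlg.algSection I V) D' ↔ D' = D) ∧
      C ⊆ D ∧
      ∀ T : Set (DiffAlg.DiffPoly k m n),
        DiffAlg.IsLeastWeakDTriangularSubset D T ↔ T = C :=
  lemmal_general d hrank I hprime hI C hC V hCV
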